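/- Let $\mathsf{D}$ be an abelian category, let $\mathsf{C}\subset\mathsf{D}$ be a Serre subcategory, and let $\kappa$ be an infinite cardinal. Let $\mathrm{Lex}\,\mathsf{D}$ be the category of left exact presheaves on $\mathsf{D}$, that is, functors $F\colon \mathsf{D}^{\mathrm{op}}\to\mathsf{Ab}$ sending every short exact sequence $0\to X\to Y\to Z\to 0$ to an exact sequence $0\to F(Z)\to F(Y)\to F(X)$; we regard $\mathsf{D}$ as a full subcategory of $\mathrm{Lex}\,\mathsf{D}$ by the Yoneda embedding. Let $\mathsf{Ind}^a_\kappa(\mathsf{D},\mathsf{C})\subset\mathrm{Lex}\,\mathsf{D}$ be the full subcategory of objects isomorphic to a colimit (in $\mathrm{Lex}\,\mathsf{D}$) $\mathrm{colim}_{i\in I}X_i$ of a diagram $X\colon I\to\mathsf{D}$ indexed by a filtered poset $I$ with $|I|\le\kappa$, such that $X_i\to X_j$ is a monomorphism for all $i\le j$ and $X_j/X_i\in\mathsf{C}$ for all $i<j$. Its exact structure is the one inherited from $\mathrm{Lex}\,\mathsf{D}$: the distinguished short exact sequences are those sequences in $\mathsf{Ind}^a_\kappa(\mathsf{D},\mathsf{C})$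 that are short exact in $\mathrm{Lex}\,\mathsf{D}$. Put $\mathsf{Pro}^a_\kappa(\mathsf{D},\mathsf{C})=(\mathsf{Ind}^a_\kappa(\mathsf{D}^{\mathrm{op}},\mathsf{C}^{\mathrm{op}}))^{\mathrm{op}}$, with the opposite exact structure. The pair $(\mathsf{D},\mathsf{C})$ is called Noetherian if for every $X\in\mathsf{D}$ every sequence of subobjects $X_0\subset X_1\subset\cdots\subset X$ with $X_{n+1}/X_n\in\mathsf{C}$ for all $n$ eventually stabilises, and Artinian if for every $X\in\mathsf{D}$ every sequence of subobjects $X\supset X_0\supset X_1\supset\cdots$ with $X_n/X_{n+1}\in\mathsf{C}$ for all $n$ eventually stabilises. Then: 1. $\mathsf{Ind}^a_\kappa(\mathsf{D},\mathsf{C})$ is equivalent, as an exact category, to an abelian category with its maximal exact structure (all short exact sequences) if and only if the pair $(\mathsf{D},\mathsf{C})$ is Noetherian. 2. $\mathsf{Pro}^a_\kappa(\mathsf{D},\mathsf{C})$ is equivalent, as an exact category, to an abelian category with its maximal exact structure if and only if the pair $(\mathsf{D},\mathsf{C})$ is Artinian. -/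

import Mathlib

open CategoryTheory CategoryTheory.Limits

universe v u w₁ w₂

namespace RelativeInd

section Lex

variable (D : Type u) [Category.{v} D] [Abelian D]

/-- A presheaf of abelian groups on the abelian category `D` is left exact if it sends every short
exact sequence `0 ⟶ X ⟶ Y ⟶ Z ⟶ 0` to an exact sequence `0 ⟶ F(Z) ⟶ F(Y) ⟶ F(X)`. -/
def isLeftExact : ObjectProperty (Dᵒᵖ ⥤ AddCommGrpCat.{v}) := fun F =>
  ∀ S : ShortComplex D, S.ShortExact →
    Function.Injective (F.map S.g.op) ∧ Function.Exact (F.map S.g.op) (F.map S.f.op)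

/-- The category `Lex D` of left exact presheaves of abelian groups on `D`. -/
abbrev Lex : Type (max u (v + 1)) := (isLeftExact D).FullSubcategory

variable {D} in
/-- Representable presheaves are left exact. -/
theorem isLeftExact_preadditiveYoneda (X : D) : isLeftExact D (preadditiveYoneda.obj X) := by
  intro S hS
  have := hS.epi_g
  refine ⟨?_, ?_⟩
  · intro a b hab
    exact (cancel_epi S.g).1 hab
  · intro b
    constructor
    · intro hb
      exact ⟨hS.gIsCokernel.desc (CokernelCofork.ofπ b hb),
        hS.gIsCokernel.fac (CokernelCofork.ofπ b hb) WalkingParallelPair.one⟩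
    · rintro ⟨(c : S.X₃ ⟶ X), (rfl : S.g ≫ c = b)⟩
      have h : S.f ≫ S.g ≫ c = 0 := by rw [← Category.assoc, S.zero, zero_comp]
      exact h

/-- The Yoneda embedding `D ⥤ Lex D`. -/
noncomputable def yonedaLex : D ⥤ Lex D :=
  (isLeftExact D).lift preadditiveYoneda isLeftExact_preadditiveYoneda

end Lex

section Conflation

variable {E : Type*} [Category E] [Preadditive E]

/-- `X ⟶ Y ⟶ Z` is a kernel-cokernel pair: the first map is a kernel of the second one, and the
second map is a cokernel of the first one. -/
def IsKernelCokernelPair (S : ShortComplex E) : Prop :=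
  Nonempty (IsLimit (KernelFork.ofι S.f S.zero)) ∧
    Nonempty (IsColimit (CokernelCofork.ofπ S.g S.zero))

end Conflation

section Ind

variable {D : Type u} [Category.{v} D] [Abelian D]

/-- An admissible Ind diagram in the abelian category `D` (all monomorphisms are admissible),
indexed by a poset `I`: all transition maps are monomorphisms. -/
def IsAdmissibleIndDiagram {I : Type v} [PartialOrder I] (X : I ⥤ D) : Prop :=
  ∀ (i j : I) (h : i ≤ j), Mono (X.map (homOfLE h))

/-- An admissible Ind diagram is relative to `C` if `X_j / X_i` lies in `C` for all `i < j`. -/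
def IsRelativeAdmissibleIndDiagram (C : ObjectProperty D) {I : Type v} [PartialOrder I]
    (X : I ⥤ D) : Prop :=
  IsAdmissibleIndDiagram X ∧
    ∀ (i j : I) (h : i < j), C (cokernel (X.map (homOfLE h.le)))

/-- The left exact presheaves which are the colimit, in `Lex D`, of an admissible Ind diagram
relative to `C` indexed by a filtered poset of cardinality at most `κ`. -/
def isRelativeInd (κ : Cardinal.{v}) (C : ObjectProperty D) : ObjectProperty (Lex D) := fun F =>
  ∃ (I : Type v) (_ : PartialOrder I) (_ : IsFiltered I) (X : I ⥤ D)
    (a : X ⋙ yonedaLex D ⟶ (Functor.const I).obj F),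
    Cardinal.mk I ≤ κ ∧ IsRelativeAdmissibleIndDiagram C X ∧
      Nonempty (IsColimit (Cocone.mk F a))

/-- The category `Ind_κ(D, C)` of relative admissible Ind objects. For `C = ⊤` this is the category
`Ind_κ(D)` of admissible Ind objects. -/
abbrev RelInd (κ : Cardinal.{v}) (C : ObjectProperty D) : Type (max u (v + 1)) :=
  (isRelativeInd κ C).FullSubcategory

/-- The exact structure of `Ind_κ(D, C)` inherited from `Lex D`: the short exact sequences
of `Lex D` all of whose terms are in `Ind_κ(D, C)`. -/
def RelInd.conflations (κ : Cardinal.{v}) (C : ObjectProperty D) :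
    ObjectProperty (ShortComplex (RelInd κ C)) := fun S =>
  IsKernelCokernelPair (S.map (isRelativeInd κ C).ι)

/-- The category `Pro_κ(D, C) = (Ind_κ(Dᵒᵖ, Cᵒᵖ))ᵒᵖ` of relative admissible Pro objects. -/
abbrev RelPro (κ : Cardinal.{v}) (C : ObjectProperty D) : Type (max u (v + 1)) :=
  (RelInd κ C.op)ᵒᵖ

/-- The exact structure of `Pro_κ(D, C)`, opposite to the one of `Ind_κ(Dᵒᵖ, Cᵒᵖ)`. -/
def RelPro.conflations (κ : Cardinal.{v}) (C : ObjectProperty D) :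
    ObjectProperty (ShortComplex (RelPro κ C)) := fun S =>
  RelInd.conflations κ C.op S.unop

/-- The pair `(D, C)` is Noetherian: in every object `X` of `D`, every ascending sequence of
subobjects `X_0 ⊆ X_1 ⊆ ⋯ ⊆ X` with all `X_{n+1} / X_n` in `C` stabilises. -/
def IsRelativelyNoetherian (C : ObjectProperty D) : Prop :=
  ∀ (X : D) (f : ℕ → Subobject X) (hf : Monotone f),
    (∀ n, C (cokernel ((f n).ofLE (f (n + 1)) (hf n.le_succ)))) →
      ∃ n, ∀ m, n ≤ m → f (m + 1) = f m

/-- The pair `(D, C)` is Artinian: in every object `X` of `D`, every descending sequence of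
subobjects `X ⊇ X_0 ⊇ X_1 ⊇ ⋯` with all `X_n / X_{n+1}` in `C` stabilises. -/
def IsRelativelyArtinian (C : ObjectProperty D) : Prop :=
  ∀ (X : D) (f : ℕ → Subobject X) (hf : Antitone f),
    (∀ n, C (cokernel ((f (n + 1)).ofLE (f n) (hf n.le_succ)))) →
      ∃ n, ∀ m, n ≤ m → f (m + 1) = f m

end Ind

/-- An additive category `E` with a class `W` of distinguished short exact sequences is equivalent
to an abelian category with its maximal exact structure: there are an abelian category `A` and an
additive equivalence `E ≌ A` under which the sequences in `W` correspond exactly to all the short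
exact sequences of `A`. -/
def IsEquivalentToAbelian {E : Type w₁} [Category.{w₂} E] [Preadditive E]
    (W : ObjectProperty (ShortComplex E)) : Prop :=
  ∃ (A : Type w₁) (_ : Category.{w₂} A) (_ : Abelian A) (e : E ≌ A)
    (_ : e.functor.Additive), ∀ S : ShortComplex E, W S ↔ (S.map e.functor).ShortExact

end RelativeInd

/-! A left exact presheaf lies in `Ind` exactly when it is an increasing filtered union of
representables `X i` with successive quotients in `C`, so its sections are morphisms into some `X
i`. Left exact presheaves behave like sheaves for the epimorphisms of `D`: kernels are computed on
sections, cokernels only after passing to an epimorphic cover.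

Kernels always stay in `Ind`. A map from the union of the `X i` to the union of the `Y j` is given
by morphisms `w i` from `X i` to some `Y j`; the kernels of the `w i` exhaust the kernel, and their
quotients embed in those of `X` (`exists_isSectionKernel`).

Cokernels need the chain condition. The image of `f` meets `Y j` in the union of the subobjects
contributed by the separate `X i`, whose quotients are subquotients of those of `X` and hence in `C`
(`prop_cokernel_ofLE`). If `(D, C)` is Noetherian this union is attained at one stage, giving a
subobject `S j` of `Y j`, and the `Y j / S j` exhaust the cokernel
(`IsRelativelyNoetherian.exists_isLocalCokernel`). Kernels and cokernels then agree with those of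
`Lex D`, so the category is abelian and its short exact sequences are the inherited ones.

Conversely, a chain of subobjects of `X` with quotients in `C` has a union `F` in `Ind`, with a
monomorphism to `X`. If `Ind` is abelian, `F` is the kernel of some map from `X` to a union of
objects `Z j`. That map factors through a single `Z j`, so `F` is a subobject of `X` in `D`, and its
inclusion already factors through one term of the chain
(`IsEquivalentToAbelian.exists_forall_factor`).

The statement on `Pro` is the one on `Ind` for the opposite pair: taking quotients reverses
inclusions of subobjects and exchanges the two chain conditions. -/

namespace RelativeInd

open Opposite ZeroObject

/-! ### Sections of left exact presheaves -/

section Sections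

variable {D : Type u} [Category.{v} D] [Abelian D]

/-- The group of sections of a left exact presheaf. -/
abbrev Sec (F : Lex D) (U : D) : Type v := F.obj.obj (op U)

/-- Restriction of sections along a morphism. -/
def res (F : Lex D) {U V : D} (u : V ⟶ U) : Sec F U →+ Sec F V := (F.obj.map u.op).hom

/-- The action of a morphism of left exact presheaves on sections. -/
def sec {F G : Lex D} (f : F ⟶ G) (U : D) : Sec F U →+ Sec G U := (f.hom.app (op U)).hom

@[simp]
theorem res_id (F : Lex D) {U : D} (x : Sec F U) : res F (𝟙 U) x = x := by
  simp [res]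

theorem res_comp (F : Lex D) {U V W : D} (u : V ⟶ U) (w : W ⟶ V) (x : Sec F U) :
    res F (w ≫ u) x = res F w (res F u x) := by
  simp [res]

theorem sec_res {F G : Lex D} (f : F ⟶ G) {U V : D} (u : V ⟶ U) (x : Sec F U) :
    sec f V (res F u x) = res G u (sec f U x) :=
  ConcreteCategory.congr_hom (f.hom.naturality u.op) x

@[simp]
theorem sec_id (F : Lex D) {U : D} (x : Sec F U) : sec (𝟙 F) U x = x := rfl

@[simp]
theorem sec_comp {F G H : Lex D} (f : F ⟶ G) (g : G ⟶ H) {U : D} (x : Sec F U) :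
    sec (f ≫ g) U x = sec g U (sec f U x) := rfl

@[simp]
theorem sec_zero {F G : Lex D} {U : D} (x : Sec F U) : sec (0 : F ⟶ G) U x = 0 := rfl

theorem lex_hom_ext {F G : Lex D} {f g : F ⟶ G} (h : ∀ U x, sec f U x = sec g U x) : f = g := by
  apply ObjectProperty.hom_ext
  ext U x
  exact h U.unop x

/-- A morphism of left exact presheaves from its action on sections. -/
def lexHomMk {F G : Lex D} (φ : ∀ U, Sec F U →+ Sec G U)
    (h : ∀ {U V : D} (u : V ⟶ U) (x : Sec F U), φ V (res F u x) = res G u (φ U x)) : F ⟶ G :=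
  ObjectProperty.homMk
    { app := fun U => AddCommGrpCat.ofHom (φ U.unop)
      naturality := fun U V u => by
        ext x
        exact h u.unop x }

theorem res_injective (F : Lex D) {U V : D} (p : V ⟶ U) [Epi p] :
    Function.Injective (res F p) :=
  (F.property (ShortComplex.mk (kernel.ι p) p (kernel.condition p))
    { exact := ShortComplex.exact_kernel p }).1

theorem exists_res_eq (F : Lex D) {U V : D} (p : V ⟶ U) [Epi p] (s : Sec F V)
    (hs : res F (kernel.ι p) s = 0) : ∃ t, res F p t = s :=
  ((F.property (ShortComplex.mk (kernel.ι p) p (kernel.condition p))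
    { exact := ShortComplex.exact_kernel p }).2 s).1 hs

theorem sec_eq_zero_of_isZero (F : Lex D) {Z : D} (hZ : IsZero Z) (x : Sec F Z) : x = 0 := by
  -- In the sequence with both maps the identity of `Z`, exactness makes the kernel of the identity
  -- of `F(Z)` equal to its image.
  have h := (F.property (ShortComplex.mk (𝟙 Z) (𝟙 Z) (hZ.eq_of_src _ _))
    { exact := ShortComplex.exact_of_isZero_X₂ _ hZ
      mono_f := inferInstanceAs (Mono (𝟙 Z))
      epi_g := inferInstanceAs (Epi (𝟙 Z)) }).2
  have h' : res F (𝟙 Z) x = 0 := (h x).2 ⟨x, res_id F x⟩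
  simpa using h'

@[simp]
theorem res_zero (F : Lex D) {U V : D} (x : Sec F U) : res F (0 : V ⟶ U) x = 0 := by
  have h : (0 : V ⟶ U) = (0 : V ⟶ 0) ≫ (0 : (0 : D) ⟶ U) := by simp
  rw [h, res_comp, sec_eq_zero_of_isZero F (isZero_zero D) (res F _ x), map_zero]

/-- Additivity of `F` is not assumed; it follows from left exactness on the split sequence `U ⟶ U ⊞
U ⟶ U`, since a section over `U ⊞ U` that vanishes on both summands is zero. The general case is
pulled back from the two projections and the codiagonal. -/
theorem res_add (F : Lex D) {U V : D} (u w : V ⟶ U) (x : Sec F U) :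
    res F (u + w) x = res F u x + res F w x := by
  have key : res F (biprod.desc (𝟙 U) (𝟙 U)) x =
      res F (biprod.fst : U ⊞ U ⟶ U) x + res F (biprod.snd : U ⊞ U ⟶ U) x := by
    let S : ShortComplex D := ShortComplex.mk (biprod.inl : U ⟶ U ⊞ U) biprod.snd (by simp)
    have hS : S.ShortExact := (ShortComplex.Splitting.ofHasBinaryBiproduct U U).shortExact
    rw [← sub_eq_zero]
    set d := res F (biprod.desc (𝟙 U) (𝟙 U)) x -
      (res F (biprod.fst : U ⊞ U ⟶ U) x + res F (biprod.snd : U ⊞ U ⟶ U) x) with hd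
    have h₁ : res F (biprod.inl : U ⟶ U ⊞ U) d = 0 := by
      simp [hd, ← res_comp]
    have h₂ : res F (biprod.inr : U ⟶ U ⊞ U) d = 0 := by
      simp [hd, ← res_comp]
    obtain ⟨e, he⟩ : ∃ e, res F (biprod.snd : U ⊞ U ⟶ U) e = d :=
      ((F.property S hS).2 d).1 h₁
    rw [← he, ← res_comp, biprod.inr_snd, res_id] at h₂
    rw [← he, h₂, map_zero]
  have h : u + w = biprod.lift u w ≫ biprod.desc (𝟙 U) (𝟙 U) := by simp
  rw [h, res_comp, key, map_add, ← res_comp, ← res_comp, biprod.lift_fst, biprod.lift_snd]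

theorem res_sub (F : Lex D) {U V : D} (u w : V ⟶ U) (x : Sec F U) :
    res F (u - w) x = res F u x - res F w x := by
  rw [eq_sub_iff_add_eq, ← res_add, sub_add_cancel]

/-- The morphism from a representable presheaf corresponding to a section. -/
noncomputable def ofSec {F : Lex D} {U : D} (x : Sec F U) : (yonedaLex D).obj U ⟶ F :=
  lexHomMk (F := (yonedaLex D).obj U) (fun V => AddMonoidHom.mk' (fun u : V ⟶ U => res F u x)
    (fun u w => res_add F u w x)) (fun {_ _} u w => res_comp F w u x)

theorem sec_of_yonedaLex {F : Lex D} {U V : D} (f : (yonedaLex D).obj U ⟶ F) (u : V ⟶ U) :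
    sec f V u = res F u (sec f U (𝟙 U)) := by
  exact (congrArg (sec f V) (Category.comp_id u).symm).trans (sec_res f u (𝟙 U : U ⟶ U))

end Sections

/-! ### Increasing unions of representables -/

section Exhaustion

variable {D : Type u} [Category.{v} D] [Abelian D]

/-- A compatible family of sections `x i` of `F` over `X i` exhibits `F` as the increasing union of
the representable presheaves of the objects `X i`. -/
structure IsExhaustion (F : Lex D) {I : Type v} [PartialOrder I] (X : I ⥤ D)
    (x : ∀ i, Sec F (X.obj i)) : Prop where
  res_map : ∀ {i j : I} (h : i ⟶ j), res F (X.map h) (x j) = x i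
  eq_zero : ∀ {i : I} {U : D} (u : U ⟶ X.obj i), res F u (x i) = 0 → u = 0
  exists_eq : ∀ {U : D} (s : Sec F U), ∃ (i : I) (u : U ⟶ X.obj i), res F u (x i) = s

variable {I : Type v} [PartialOrder I] {X : I ⥤ D}

theorem res_map_sec_app {F : Lex D} (a : X ⋙ yonedaLex D ⟶ (Functor.const I).obj F) {i j : I}
    (h : i ⟶ j) : res F (X.map h) (sec (a.app j) _ (𝟙 (X.obj j))) =
      sec (a.app i) _ (𝟙 (X.obj i)) := by
  have h₁ : (X ⋙ yonedaLex D).map h ≫ a.app j = a.app i := (Cocone.mk F a).w h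
  rw [← h₁]
  exact (sec_of_yonedaLex (a.app j) (X.map h)).symm.trans
    (congrArg (sec (a.app j) _) (Category.id_comp (X.map h)).symm)

namespace IsExhaustion

variable {F : Lex D} {x : ∀ i, Sec F (X.obj i)} (hx : IsExhaustion F X x)

include hx

theorem eq_of_res_eq {i : I} {U : D} {u w : U ⟶ X.obj i}
    (h : res F u (x i) = res F w (x i)) : u = w := by
  rw [← sub_eq_zero]
  apply hx.eq_zero
  rw [res_sub, h, sub_self]

theorem res_comp_map {i j : I} (h : i ⟶ j) {U : D} (u : U ⟶ X.obj i) :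
    res F (u ≫ X.map h) (x j) = res F u (x i) := by
  rw [res_comp, hx.res_map]

theorem mono_map {i j : I} (h : i ⟶ j) : Mono (X.map h) := by
  apply Preadditive.mono_of_cancel_zero
  intro U u hu
  apply hx.eq_zero
  rw [← hx.res_comp_map h, hu, res_zero]

theorem exists_eq_of_le [IsFiltered I] {U : D} (s : Sec F U) (k : I) :
    ∃ (i : I) (_ : k ⟶ i) (u : U ⟶ X.obj i), res F u (x i) = s := by
  obtain ⟨i, u, hu⟩ := hx.exists_eq s
  exact ⟨IsFiltered.max k i, IsFiltered.leftToMax k i, u ≫ X.map (IsFiltered.rightToMax k i),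
    by rw [hx.res_comp_map, hu]⟩

/-- Sections of the union determine a morphism to any other presheaf with a compatible family. -/
theorem exists_desc [IsFiltered I] {G : Lex D} (g : ∀ i, Sec G (X.obj i))
    (hg : ∀ {i j : I} (h : i ⟶ j), res G (X.map h) (g j) = g i) :
    ∃ f : F ⟶ G, ∀ i, sec f _ (x i) = g i := by
  -- Two representatives of one section become equal at a common later stage, so the value in `G`
  -- does not depend on the representative.
  have key : ∀ {U : D} {i j : I} (u : U ⟶ X.obj i) (w : U ⟶ X.obj j),
      res F u (x i) = res F w (x j) → res G u (g i) = res G w (g j) := by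
    intro U i j u w h
    have h' : u ≫ X.map (IsFiltered.leftToMax i j) = w ≫ X.map (IsFiltered.rightToMax i j) := by
      apply hx.eq_of_res_eq
      rw [hx.res_comp_map, hx.res_comp_map, h]
    rw [← hg (IsFiltered.leftToMax i j), ← hg (IsFiltered.rightToMax i j), ← res_comp, ← res_comp,
      h']
  choose idx u hu using fun (U : D) (s : Sec F U) => hx.exists_eq s
  have hval : ∀ {U : D} (s : Sec F U) {i : I} (w : U ⟶ X.obj i), res F w (x i) = s →
      res G (u U s) (g (idx U s)) = res G w (g i) := by
    intro U s i w h
    exact key _ _ (by rw [hu, h])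
  refine ⟨lexHomMk (fun U => AddMonoidHom.mk' (fun s => res G (u U s) (g (idx U s))) ?_) ?_, ?_⟩
  · intro a b
    let k := IsFiltered.max (idx U a) (idx U b)
    let l : idx U a ⟶ k := IsFiltered.leftToMax _ _
    let r : idx U b ⟶ k := IsFiltered.rightToMax _ _
    rw [hval (a + b) (u U a ≫ X.map l + u U b ≫ X.map r)
      (by rw [res_add, hx.res_comp_map, hx.res_comp_map, hu, hu]), res_add, res_comp, res_comp,
      hg, hg]
  · intro U V w s
    change res G (u V (res F w s)) (g (idx V (res F w s))) = res G w (res G (u U s) (g (idx U s)))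
    rw [hval (res F w s) (w ≫ u U s) (by rw [res_comp, hu]), res_comp]
  · intro i
    change res G (u _ (x i)) (g (idx _ (x i))) = g i
    rw [hval (x i) (𝟙 _) (res_id _ _), res_id]

theorem hom_ext {G : Lex D} {f g : F ⟶ G} (h : ∀ i, sec f _ (x i) = sec g _ (x i)) : f = g := by
  apply lex_hom_ext
  intro U s
  obtain ⟨i, u, rfl⟩ := hx.exists_eq s
  rw [sec_res, sec_res, h]

/-- The cocone of an exhaustion is a colimit. -/
theorem exists_isColimit [IsFiltered I] :
    ∃ a : X ⋙ yonedaLex D ⟶ (Functor.const I).obj F, Nonempty (IsColimit (Cocone.mk F a)) := by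
  refine ⟨{ app := fun i => ofSec (x i), naturality := fun i j h => ?_ }, ⟨?_⟩⟩
  · apply lex_hom_ext
    intro U u
    exact hx.res_comp_map h u
  · have hd := fun s : Cocone (X ⋙ yonedaLex D) =>
      hx.exists_desc (fun i => sec (s.ι.app i) _ (𝟙 (X.obj i))) (res_map_sec_app s.ι)
    choose d hd using hd
    refine ⟨d, fun s i => ?_, fun s m hm => ?_⟩
    · apply lex_hom_ext
      intro U (u : U ⟶ X.obj i)
      change sec (d s) U (res F u (x i)) = _
      rw [sec_res, hd, ← sec_of_yonedaLex]
    · apply hx.hom_ext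
      intro i
      rw [hd, ← hm i]
      change _ = sec m _ (res F (𝟙 _) (x i))
      rw [res_id]

end IsExhaustion

/-- The union, in presheaves, of an admissible diagram is left exact. -/
theorem exists_isExhaustion [IsFiltered I] (hX : ∀ {i j : I} (h : i ⟶ j), Mono (X.map h)) :
    ∃ (F : Lex D) (x : ∀ i, Sec F (X.obj i)), IsExhaustion F X x := by
  let K : I ⥤ Dᵒᵖ ⥤ AddCommGrpCat.{v} := X ⋙ preadditiveYoneda
  let T := colimit K
  let R : ∀ {U V : D} (w : V ⟶ U), T.obj (op U) →+ T.obj (op V) := fun w => (T.map w.op).hom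
  let c : ∀ (i : I) (U : D), (U ⟶ X.obj i) →+ T.obj (op U) :=
    fun i U => ((colimit.ι K i).app (op U)).hom
  have hT : ∀ U : D, IsColimit (((evaluation _ _).obj (op U)).mapCocone (colimit.cocone K)) :=
    fun U => isColimitOfPreserves _ (colimit.isColimit K)
  have hR : ∀ (i : I) {U V : D} (w : V ⟶ U) (u : U ⟶ X.obj i), R w (c i U u) = c i V (w ≫ u) :=
    fun i U V w u => (ConcreteCategory.congr_hom ((colimit.ι K i).naturality w.op) u).symm
  have hc : ∀ {i j : I} (h : i ⟶ j) {U : D} (u : U ⟶ X.obj i), c j U (u ≫ X.map h) = c i U u :=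
    fun h U u => ConcreteCategory.congr_hom (congrArg (fun t => NatTrans.app t (op U))
      (colimit.w K h)) u
  have hex : ∀ {U : D} (s : T.obj (op U)), ∃ (i : I) (u : U ⟶ X.obj i), c i U u = s :=
    fun {U} s => Concrete.isColimit_exists_rep _ (hT U) s
  have hz : ∀ {U : D} (i : I) (u : U ⟶ X.obj i), c i U u = 0 → u = 0 := by
    intro U i u h
    obtain ⟨k, f, g, hk⟩ := (Concrete.isColimit_rep_eq_iff_exists (i := i) (j := i) _ (hT U) u
      (0 : U ⟶ X.obj i)).1 (h.trans (map_zero (c i U)).symm)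
    have hk' : u ≫ X.map f = 0 ≫ X.map g := hk
    have := hX f
    rwa [zero_comp, ← zero_comp (f := X.map f), cancel_mono] at hk'
  -- By `hz` a morphism into `X i` that dies in the colimit is already zero, so exactness is checked
  -- on one representable.
  have hlex : isLeftExact D T := by
    intro S hS
    have := hS.epi_g
    refine ⟨?_, ?_⟩
    · change Function.Injective (R S.g)
      rw [injective_iff_map_eq_zero]
      intro s hs
      obtain ⟨i, u, rfl⟩ := hex s
      rw [hR] at hs
      have := hz _ _ hs
      rw [← comp_zero (f := S.g), cancel_epi] at this
      rw [this, map_zero]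
    · change Function.Exact (R S.g) (R S.f)
      intro s
      constructor
      · intro hs
        obtain ⟨i, u, rfl⟩ := hex s
        rw [hR] at hs
        refine ⟨c i _ (hS.exact.desc u (hz _ _ hs)), ?_⟩
        rw [hR, hS.exact.g_desc]
      · rintro ⟨t, rfl⟩
        obtain ⟨i, u, rfl⟩ := hex t
        rw [hR, hR, S.zero_assoc, zero_comp, map_zero]
  refine ⟨⟨T, hlex⟩, fun i => c i _ (𝟙 _), fun h => ?_, fun {i U} u hu => ?_, fun {U} s => ?_⟩
  · change R _ _ = _
    rw [hR, Category.comp_id, ← hc h, Category.id_comp]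
  · change R _ _ = _ at hu
    rw [hR, Category.comp_id] at hu
    exact hz _ _ hu
  · obtain ⟨i, u, rfl⟩ := hex s
    refine ⟨i, u, ?_⟩
    change R _ _ = _
    rw [hR, Category.comp_id]

/-- A colimit of an admissible diagram is exhausted by it. -/
theorem isExhaustion_of_isColimit [IsFiltered I] (hX : ∀ {i j : I} (h : i ⟶ j), Mono (X.map h))
    {F : Lex D} (a : X ⋙ yonedaLex D ⟶ (Functor.const I).obj F)
    (ha : IsColimit (Cocone.mk F a)) :
    IsExhaustion F X (fun i => sec (a.app i) _ (𝟙 (X.obj i))) := by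
  obtain ⟨T, t, ht⟩ := exists_isExhaustion hX
  obtain ⟨b, ⟨hb⟩⟩ := ht.exists_isColimit
  obtain ⟨g, hg⟩ := ht.exists_desc (fun i => sec (a.app i) _ (𝟙 (X.obj i))) (res_map_sec_app a)
  -- It suffices that `F` is a retract of the union `T`, compatibly with the universal sections: `f`
  -- carries vanishing of sections to `T`, and `g` carries representatives back.
  have hgf : ∃ f : F ⟶ T, f ≫ g = 𝟙 F ∧
      ∀ i, sec f _ (sec (a.app i) _ (𝟙 (X.obj i))) = t i := by
    let s : Cocone (X ⋙ yonedaLex D) := Cocone.mk T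
      { app := fun i => ofSec (t i)
        naturality := fun i j h => by
          apply lex_hom_ext
          intro U u
          exact ht.res_comp_map h u }
    have hs : ∀ i, a.app i ≫ ha.desc s = ofSec (t i) := fun i => ha.fac s i
    refine ⟨ha.desc s, ?_, fun i => ?_⟩
    · apply ha.hom_ext
      intro i
      change a.app i ≫ ha.desc s ≫ g = a.app i ≫ 𝟙 F
      rw [← Category.assoc, hs]
      apply lex_hom_ext
      intro U (u : U ⟶ X.obj i)
      change sec g U (res T u (t i)) = _
      rw [sec_res, hg, ← sec_of_yonedaLex]
      rfl
    · exact (congrArg (fun m => sec m _ (𝟙 (X.obj i))) (hs i)).trans (res_id T (t i))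
  obtain ⟨f, hfg, hf⟩ := hgf
  refine ⟨res_map_sec_app a, fun {i U} u hu => ?_, fun {U} s => ?_⟩
  · apply ht.eq_zero
    rw [← hf i, ← sec_res, hu, map_zero]
  · obtain ⟨i, u, hu⟩ := ht.exists_eq (sec f U s)
    refine ⟨i, u, ?_⟩
    rw [← hg, ← sec_res, hu, ← sec_comp, hfg, sec_id]

/-- The objects of `Ind_κ(D, C)` in terms of exhaustions. -/
theorem isRelativeInd_iff {κ : Cardinal.{v}} {C : ObjectProperty D} {F : Lex D} :
    isRelativeInd κ C F ↔ ∃ (I : Type v) (_ : PartialOrder I) (_ : IsFiltered I) (X : I ⥤ D)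
      (x : ∀ i, Sec F (X.obj i)), Cardinal.mk I ≤ κ ∧
        (∀ (i j : I) (h : i < j), C (cokernel (X.map (homOfLE h.le)))) ∧ IsExhaustion F X x := by
  constructor
  · rintro ⟨I, hI, hI', X, a, hκ, ⟨hX, hC⟩, ⟨ha⟩⟩
    exact ⟨I, hI, hI', X, _, hκ, hC, isExhaustion_of_isColimit (fun h => hX _ _ (leOfHom h)) a ha⟩
  · rintro ⟨I, hI, hI', X, x, hκ, hC, hx⟩
    obtain ⟨a, ha⟩ := hx.exists_isColimit
    exact ⟨I, hI, hI', X, a, hκ, ⟨fun i j h => hx.mono_map _, hC⟩, ha⟩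

theorem isRelativeInd_yonedaLex {κ : Cardinal.{v}} (hκ : Cardinal.aleph0 ≤ κ)
    (C : ObjectProperty D) (X : D) : isRelativeInd κ C ((yonedaLex D).obj X) := by
  rw [isRelativeInd_iff]
  refine ⟨PUnit, inferInstance, inferInstance, (Functor.const _).obj X, fun _ => 𝟙 X,
    ?_, fun i j h => ?_, fun h => ?_, fun u hu => ?_, fun s => ?_⟩
  · simpa using Cardinal.one_le_aleph0.trans hκ
  · exact absurd h (by simp)
  · exact Category.comp_id _
  · exact (Category.comp_id u).symm.trans hu
  · exact ⟨PUnit.unit, s, Category.comp_id _⟩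

end Exhaustion

/-! ### Kernels, local cokernels and products -/

section Constructions

variable {D : Type u} [Category.{v} D] [Abelian D]

/-- `k` is a kernel of `f` on sections. -/
structure IsSectionKernel {K F G : Lex D} (k : K ⟶ F) (f : F ⟶ G) : Prop where
  comp : k ≫ f = 0
  injective : ∀ U, Function.Injective (sec k U)
  exists_eq : ∀ {U : D} (s : Sec F U), sec f U s = 0 → ∃ t, sec k U t = s

/-- `q` is a cokernel of `f` on sections, up to passing to epimorphic covers. -/
structure IsLocalCokernel {F G Q : Lex D} (f : F ⟶ G) (q : G ⟶ Q) : Prop where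
  comp : f ≫ q = 0
  exists_lift : ∀ {U : D} (s : Sec Q U), ∃ (V : D) (p : V ⟶ U) (_ : Epi p) (t : Sec G V),
    sec q V t = res Q p s
  exists_eq : ∀ {U : D} (s : Sec G U), sec q U s = 0 →
    ∃ (V : D) (p : V ⟶ U) (_ : Epi p) (t : Sec F V), sec f V t = res G p s

theorem IsSectionKernel.exists_lift {K F G T : Lex D} {k : K ⟶ F} {f : F ⟶ G}
    (h : IsSectionKernel k f) (t : T ⟶ F) (ht : t ≫ f = 0) : ∃ l : T ⟶ K, l ≫ k = t := by
  have h' : ∀ U (s : Sec T U), ∃ r, sec k U r = sec t U s := fun U s =>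
    h.exists_eq _ (by rw [← sec_comp, ht, sec_zero])
  choose l hl using h'
  refine ⟨lexHomMk (fun U => AddMonoidHom.mk' (l U) ?_) ?_, ?_⟩
  · intro a b
    apply h.injective
    rw [hl, map_add, map_add, hl, hl]
  · intro U V u x
    apply h.injective
    change sec k V (l V _) = sec k V (res K u (l U x))
    rw [hl, sec_res, sec_res, hl]
  · exact lex_hom_ext hl

theorem IsSectionKernel.hom_ext {K F G T : Lex D} {k : K ⟶ F} {f : F ⟶ G}
    (h : IsSectionKernel k f) {a b : T ⟶ K} (hab : a ≫ k = b ≫ k) : a = b :=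
  lex_hom_ext fun U x => h.injective U (by rw [← sec_comp, hab, sec_comp])

theorem IsLocalCokernel.hom_ext {F G Q T : Lex D} {f : F ⟶ G} {q : G ⟶ Q}
    (h : IsLocalCokernel f q) {a b : Q ⟶ T} (hab : q ≫ a = q ≫ b) : a = b := by
  apply lex_hom_ext
  intro U s
  obtain ⟨V, p, _, t, ht⟩ := h.exists_lift s
  apply res_injective T p
  rw [← sec_res, ← sec_res, ← ht, ← sec_comp, hab, sec_comp]

theorem IsLocalCokernel.exists_desc {F G Q T : Lex D} {f : F ⟶ G} {q : G ⟶ Q}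
    (h : IsLocalCokernel f q) (t : G ⟶ T) (ht : f ≫ t = 0) : ∃ d : Q ⟶ T, q ≫ d = t := by
  have hker : ∀ {U : D} (s : Sec G U), sec q U s = 0 → sec t U s = 0 := by
    intro U s hs
    obtain ⟨V, p, _, r, hr⟩ := h.exists_eq s hs
    apply res_injective T p
    rw [← sec_res, ← hr, ← sec_comp, ht, sec_zero, map_zero]
  have hker' : ∀ {U : D} (s s' : Sec G U), sec q U s = sec q U s' → sec t U s = sec t U s' := by
    intro U s s' hs
    rw [← sub_eq_zero, ← map_sub]
    exact hker _ (by rw [map_sub, hs, sub_self])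
  -- The value `r` is tested against every local lift, not only the chosen one; additivity and
  -- naturality can then be verified on any convenient cover.
  have hex : ∀ (U : D) (s : Sec Q U), ∃ r : Sec T U, ∀ {V : D} (p : V ⟶ U) (g : Sec G V),
      sec q V g = res Q p s → res T p r = sec t V g := by
    intro U s
    obtain ⟨V, p, _, g, hg⟩ := h.exists_lift s
    obtain ⟨r, hr⟩ := exists_res_eq T p (sec t V g) (by
      rw [← sec_res]
      apply hker
      rw [sec_res, hg, ← res_comp, kernel.condition, res_zero])
    refine ⟨r, fun {V'} p' g' hg' => ?_⟩
    -- Two lifts are compared over the fibre product of their domains, which still covers `V'`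
    -- because `p` is an epimorphism.
    apply res_injective T (pullback.fst p' p)
    rw [← res_comp, pullback.condition, res_comp, hr, ← sec_res, ← sec_res]
    apply hker'
    rw [sec_res, sec_res, hg, hg', ← res_comp, ← res_comp, pullback.condition]
  choose d hd using hex
  refine ⟨lexHomMk (fun U => AddMonoidHom.mk' (d U) ?_) ?_, ?_⟩
  · intro a b
    obtain ⟨V, p, _, r, hr⟩ := h.exists_lift a
    obtain ⟨V', p', _, r', hr'⟩ := h.exists_lift (res Q p b)
    apply res_injective T (p' ≫ p)
    rw [map_add, hd U a (p' ≫ p) (res G p' r) (by rw [sec_res, hr, res_comp]),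
      hd U b (p' ≫ p) r' (by rw [hr', res_comp]),
      hd U (a + b) (p' ≫ p) (res G p' r + r')
        (by rw [map_add, sec_res, hr, hr', map_add, res_comp, res_comp]), map_add]
  · intro U V u s
    obtain ⟨V', p, _, r, hr⟩ := h.exists_lift (res Q u s)
    apply res_injective T p
    change res T p (d V _) = res T p (res T u (d U s))
    rw [← res_comp, hd V _ p r hr, hd U s (p ≫ u) r (by rw [hr, res_comp])]
  · apply lex_hom_ext
    intro U s
    change d U (sec q U s) = _
    rw [← res_id T (d U _), hd U _ (𝟙 U) s (by rw [res_id])]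

/-- A morphism injective on sections is the kernel of its local cokernel. -/
theorem IsLocalCokernel.isSectionKernel {F G Q : Lex D} {f : F ⟶ G} {q : G ⟶ Q}
    (h : IsLocalCokernel f q) (hf : ∀ U, Function.Injective (sec f U)) : IsSectionKernel f q where
  comp := h.comp
  injective := hf
  exists_eq {U} s hs := by
    obtain ⟨V, p, _, t, ht⟩ := h.exists_eq s hs
    obtain ⟨r, hr⟩ := exists_res_eq F p t (by
      apply hf
      rw [sec_res, ht, ← res_comp, kernel.condition, res_zero, map_zero])
    refine ⟨r, res_injective G p ?_⟩
    rw [← sec_res, hr, ht]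

/-- A locally surjective morphism is the local cokernel of its kernel. -/
theorem IsSectionKernel.isLocalCokernel {K F G : Lex D} {k : K ⟶ F} {f : F ⟶ G}
    (h : IsSectionKernel k f)
    (hf : ∀ {U : D} (s : Sec G U), ∃ (V : D) (p : V ⟶ U) (_ : Epi p) (t : Sec F V),
      sec f V t = res G p s) : IsLocalCokernel k f where
  comp := h.comp
  exists_lift := hf
  exists_eq {U} s hs := by
    obtain ⟨t, ht⟩ := h.exists_eq s hs
    exact ⟨U, 𝟙 U, inferInstance, t, by rw [ht, res_id]⟩

section SerreClass

variable {C : ObjectProperty D} [C.IsSerreClass]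

theorem prop_cokernel_of_epi {A B : D} (f : A ⟶ B) [Epi f] : C (cokernel f) :=
  C.prop_of_isZero (isZero_cokernel_of_epi f)

theorem prop_cokernel_map {I : Type v} [PartialOrder I] {X : I ⥤ D}
    (hC : ∀ (i j : I) (h : i < j), C (cokernel (X.map (homOfLE h.le)))) {i j : I} (h : i ⟶ j) :
    C (cokernel (X.map h)) := by
  rcases (leOfHom h).eq_or_lt with rfl | h'
  · obtain rfl : h = 𝟙 i := Subsingleton.elim _ _
    exact prop_cokernel_of_epi _
  · exact hC i j h'

/-- The cokernel of `f` embeds into `N` if `f` is the kernel of a morphism to `N`. -/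
theorem prop_cokernel_of_exact {A B N : D} (f : A ⟶ B) (g : B ⟶ N) (hN : C N) (hfg : f ≫ g = 0)
    (h : ∀ {U : D} (u : U ⟶ B), u ≫ g = 0 → ∃ w, w ≫ f = u) : C (cokernel f) := by
  have hS : (ShortComplex.mk f g hfg).Exact := by
    rw [ShortComplex.exact_iff_exact_up_to_refinements]
    intro U u hu
    obtain ⟨w, hw⟩ := h u hu
    exact ⟨U, 𝟙 U, inferInstance, w, by simp [hw]⟩
  have := hS.mono_cokernelDesc
  exact C.prop_of_mono (cokernel.desc f g hfg) hN

end SerreClass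

variable {κ : Cardinal.{v}} {C : ObjectProperty D} [C.IsSerreClass]

/-- No chain condition is needed: the part of the kernel lying in `X i` is the kernel of one
morphism of `D`. -/
theorem exists_isSectionKernel {F G : Lex D} (hF : isRelativeInd κ C F)
    (hG : isRelativeInd κ C G) (f : F ⟶ G) :
    ∃ (K : Lex D) (k : K ⟶ F), isRelativeInd κ C K ∧ IsSectionKernel k f := by
  obtain ⟨I, _, _, X, x, hκ, hC, hx⟩ := isRelativeInd_iff.1 hF
  obtain ⟨J, _, _, Y, y, -, -, hy⟩ := isRelativeInd_iff.1 hG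
  choose j w hw using fun i => hy.exists_eq (sec f _ (x i))
  -- The indices `j i` are chosen with no compatibility in `i`. This equivalence characterises the
  -- kernel of `w i` in terms of `f` alone, so the choices do not matter.
  have hker : ∀ {i : I} {U : D} (u : U ⟶ X.obj i),
      sec f U (res F u (x i)) = 0 ↔ u ≫ w i = 0 := by
    intro i U u
    rw [sec_res, ← hw, ← res_comp]
    exact ⟨hy.eq_zero _, fun h => by rw [h, res_zero]⟩
  have hι : ∀ {i i' : I} (h : i ⟶ i'), (kernel.ι (w i) ≫ X.map h) ≫ w i' = 0 := by
    intro i i' h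
    rw [← hker, hx.res_comp_map, hker, kernel.condition]
  let Z : I ⥤ D :=
    { obj := fun i => kernel (w i)
      map := fun h => kernel.lift _ _ (hι h)
      map_id := fun i => by
        rw [← cancel_mono (kernel.ι _)]
        simp
      map_comp := fun h h' => by
        rw [← cancel_mono (kernel.ι _)]
        simp }
  have hZ : ∀ {i i' : I} (h : i ⟶ i'), Z.map h ≫ kernel.ι (w i') = kernel.ι (w i) ≫ X.map h :=
    fun h => kernel.lift_ι _ _ _
  have hmono : ∀ {i i' : I} (h : i ⟶ i'), Mono (Z.map h) := by
    intro i i' h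
    have := hx.mono_map h
    exact mono_of_mono_fac (hZ h)
  obtain ⟨K, z, hz⟩ := exists_isExhaustion hmono
  obtain ⟨k, hk⟩ := hz.exists_desc (fun i => res F (kernel.ι (w i)) (x i)) (fun {i i'} h => by
    rw [← res_comp, hZ, hx.res_comp_map])
  refine ⟨K, k, isRelativeInd_iff.2 ⟨I, _, inferInstance, Z, z, hκ, fun i i' h => ?_, hz⟩, ?_⟩
  · have := hx.mono_map (homOfLE h.le)
    -- The part of the kernel of `w i'` lying in `X i` is the kernel of `w i`, so the quotient
    -- embeds in `X i' / X i`.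
    refine prop_cokernel_of_exact _ (kernel.ι (w i') ≫ cokernel.π (X.map (homOfLE h.le)))
      (hC i i' h) ?_ ?_
    · rw [← Category.assoc, hZ, Category.assoc, cokernel.condition, comp_zero]
    · intro U u hu
      rw [← Category.assoc] at hu
      have hex := ShortComplex.exact_cokernel (X.map (homOfLE h.le))
      have : Mono (ShortComplex.mk _ _ (cokernel.condition (X.map (homOfLE h.le)))).f := this
      have hl : hex.lift _ hu ≫ X.map (homOfLE h.le) = u ≫ kernel.ι (w i') := hex.lift_f _ hu
      refine ⟨kernel.lift (w i) (hex.lift _ hu) ?_, ?_⟩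
      · rw [← hker, ← hx.res_comp_map (homOfLE h.le), hl, hker, Category.assoc, kernel.condition,
          comp_zero]
      · rw [← cancel_mono (kernel.ι (w i')), Category.assoc, hZ, kernel.lift_ι_assoc, hl]
  · refine ⟨?_, fun U => ?_, fun {U} s hs => ?_⟩
    · apply hz.hom_ext
      intro i
      rw [sec_comp, hk]
      exact (hker (kernel.ι (w i))).2 (kernel.condition _)
    · rw [injective_iff_map_eq_zero]
      intro s hs
      obtain ⟨i, u, rfl⟩ := hz.exists_eq s
      rw [sec_res, hk, ← res_comp] at hs
      have := hx.eq_zero _ hs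
      rw [← zero_comp (f := kernel.ι (w i)), cancel_mono] at this
      rw [this, res_zero]
    · obtain ⟨i, u, rfl⟩ := hx.exists_eq s
      refine ⟨res K (kernel.lift (w i) u ((hker u).1 hs)) (z i), ?_⟩
      rw [sec_res, hk, ← res_comp, kernel.lift_ι]

/-- The product of two presheaves of abelian groups. -/
def prodPresheaf (F G : Dᵒᵖ ⥤ AddCommGrpCat.{v}) : Dᵒᵖ ⥤ AddCommGrpCat.{v} where
  obj U := AddCommGrpCat.of (F.obj U × G.obj U)
  map u := AddCommGrpCat.ofHom (AddMonoidHom.prodMap (F.map u).hom (G.map u).hom)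
  map_id U := by
    apply AddCommGrpCat.hom_ext
    apply AddMonoidHom.ext
    intro x
    exact Prod.ext (ConcreteCategory.congr_hom (F.map_id U) x.1)
      (ConcreteCategory.congr_hom (G.map_id U) x.2)
  map_comp u w := by
    apply AddCommGrpCat.hom_ext
    apply AddMonoidHom.ext
    intro x
    exact Prod.ext (ConcreteCategory.congr_hom (F.map_comp u w) x.1)
      (ConcreteCategory.congr_hom (G.map_comp u w) x.2)

theorem isLeftExact_prodPresheaf (F G : Lex D) : isLeftExact D (prodPresheaf F.obj G.obj) := by
  intro S hS
  obtain ⟨hF, hF'⟩ := F.property S hS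
  obtain ⟨hG, hG'⟩ := G.property S hS
  refine ⟨fun x y h => ?_, fun x => ⟨fun hx => ?_, ?_⟩⟩
  · exact Prod.ext (hF (congrArg Prod.fst h)) (hG (congrArg Prod.snd h))
  · obtain ⟨a, ha⟩ := (hF' x.1).1 (congrArg Prod.fst hx)
    obtain ⟨b, hb⟩ := (hG' x.2).1 (congrArg Prod.snd hx)
    exact ⟨(a, b), Prod.ext ha hb⟩
  · rintro ⟨⟨a, b⟩, rfl⟩
    exact Prod.ext ((hF' _).2 ⟨a, rfl⟩) ((hG' _).2 ⟨b, rfl⟩)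

/-- The product of two left exact presheaves. -/
def prodLex (F G : Lex D) : Lex D := ⟨prodPresheaf F.obj G.obj, isLeftExact_prodPresheaf F G⟩

theorem isRelativeInd_prodLex_of_isExhaustion {F G : Lex D} {P : Type v} [PartialOrder P]
    [IsFiltered P] {X Y : P ⥤ D} {x : ∀ i, Sec F (X.obj i)} {y : ∀ i, Sec G (Y.obj i)}
    (hC : ∀ {i j : P} (h : i ⟶ j), C (cokernel (X.map h)))
    (hC' : ∀ {i j : P} (h : i ⟶ j), C (cokernel (Y.map h)))
    (hx : IsExhaustion F X x) (hy : IsExhaustion G Y y) (hP : Cardinal.mk P ≤ κ) :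
    isRelativeInd κ C (prodLex F G) := by
  let Z : P ⥤ D :=
    { obj := fun i => X.obj i ⊞ Y.obj i
      map := fun h => biprod.map (X.map h) (Y.map h)
      map_id := fun i => by
        rw [X.map_id, Y.map_id]
        ext <;> simp
      map_comp := fun h h' => by
        rw [X.map_comp, Y.map_comp]
        ext <;> simp }
  refine isRelativeInd_iff.2 ⟨P, inferInstance, inferInstance, Z,
    fun i => (res F (biprod.fst : X.obj i ⊞ Y.obj i ⟶ X.obj i) (x i),
      res G (biprod.snd : X.obj i ⊞ Y.obj i ⟶ Y.obj i) (y i)), hP, fun i j h => ?_,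
    fun {i j} h => ?_, fun {i U} u hu => ?_, fun {U} s => ?_⟩
  · have hm := hx.mono_map (homOfLE h.le)
    have hm' := hy.mono_map (homOfLE h.le)
    refine prop_cokernel_of_exact (biprod.map (X.map (homOfLE h.le)) (Y.map (homOfLE h.le)))
      (biprod.map (cokernel.π (X.map (homOfLE h.le))) (cokernel.π (Y.map (homOfLE h.le))))
      (C.prop_biprod (hC _) (hC' _)) ?_ ?_
    · ext <;> simp
    · intro U u hu
      have h₁ : (u ≫ biprod.fst) ≫ cokernel.π (X.map (homOfLE h.le)) = 0 := by
        simpa using hu =≫ biprod.fst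
      have h₂ : (u ≫ biprod.snd) ≫ cokernel.π (Y.map (homOfLE h.le)) = 0 := by
        simpa using hu =≫ biprod.snd
      refine ⟨biprod.lift (Abelian.monoLift (X.map (homOfLE h.le)) _ h₁)
        (Abelian.monoLift (Y.map (homOfLE h.le)) _ h₂), ?_⟩
      ext <;> simp
  · refine Prod.ext ?_ ?_
    · change res F (biprod.map (X.map h) (Y.map h))
        (res F (biprod.fst : X.obj j ⊞ Y.obj j ⟶ X.obj j) (x j)) = _
      rw [← res_comp, biprod.map_fst, hx.res_comp_map]
    · change res G (biprod.map (X.map h) (Y.map h))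
        (res G (biprod.snd : X.obj j ⊞ Y.obj j ⟶ Y.obj j) (y j)) = _
      rw [← res_comp, biprod.map_snd, hy.res_comp_map]
  · have h₁ : res F u (res F (biprod.fst : X.obj i ⊞ Y.obj i ⟶ X.obj i) (x i)) = 0 :=
      congrArg Prod.fst hu
    have h₂ : res G u (res G (biprod.snd : X.obj i ⊞ Y.obj i ⟶ Y.obj i) (y i)) = 0 :=
      congrArg Prod.snd hu
    rw [← res_comp] at h₁ h₂
    exact biprod.hom_ext _ _ (by rw [hx.eq_zero _ h₁, zero_comp])
      (by rw [hy.eq_zero _ h₂, zero_comp])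
  · obtain ⟨i, c, hc⟩ := hx.exists_eq s.1
    obtain ⟨p, h, d, hd⟩ := hy.exists_eq_of_le s.2 i
    refine ⟨p, biprod.lift (c ≫ X.map h) d, Prod.ext ?_ ?_⟩
    · change res F (biprod.lift (c ≫ X.map h) d)
        (res F (biprod.fst : X.obj p ⊞ Y.obj p ⟶ X.obj p) (x p)) = _
      rw [← res_comp, biprod.lift_fst, hx.res_comp_map, hc]
    · change res G (biprod.lift (c ≫ X.map h) d)
        (res G (biprod.snd : X.obj p ⊞ Y.obj p ⟶ Y.obj p) (y p)) = _
      rw [← res_comp, biprod.lift_snd, hd]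

theorem IsExhaustion.comp {F : Lex D} {I P : Type v} [PartialOrder I] [PartialOrder P] {X : I ⥤ D}
    {x : ∀ i, Sec F (X.obj i)} (hx : IsExhaustion F X x) (a : P →o I) (ha : ∀ i, ∃ p, i ≤ a p) :
    IsExhaustion F (a.monotone.functor ⋙ X) (fun p => x (a p)) where
  res_map h := hx.res_map (homOfLE (a.monotone (leOfHom h)))
  eq_zero u hu := hx.eq_zero u hu
  exists_eq s := by
    obtain ⟨i, u, hu⟩ := hx.exists_eq s
    obtain ⟨p, hp⟩ := ha i
    exact ⟨p, u ≫ X.map (homOfLE hp), (hx.res_comp_map (homOfLE hp) u).trans hu⟩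

/-- The category structure is named explicitly: it is that of the product order, as the index set of
an exhaustion must be a poset. -/
theorem isFiltered_prod (I J : Type v) [PartialOrder I] [PartialOrder J] [IsFiltered I]
    [IsFiltered J] : @IsFiltered (I × J) (Preorder.smallCategory _) := by
  have : Nonempty I := IsFiltered.nonempty
  have : Nonempty J := IsFiltered.nonempty
  have : IsDirectedOrder (I × J) := ⟨fun a b =>
    ⟨(IsFiltered.max a.1 b.1, IsFiltered.max a.2 b.2),
      ⟨leOfHom (IsFiltered.leftToMax _ _), leOfHom (IsFiltered.leftToMax _ _)⟩,
      ⟨leOfHom (IsFiltered.rightToMax _ _), leOfHom (IsFiltered.rightToMax _ _)⟩⟩⟩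
  exact isFiltered_of_directed_le_nonempty _

/-- Both exhaustions are reindexed over `I × J`, whose cardinality is at most `κ * κ = κ` since `κ`
is infinite. -/
theorem isRelativeInd_prodLex (hκ : Cardinal.aleph0 ≤ κ) {F G : Lex D}
    (hF : isRelativeInd κ C F) (hG : isRelativeInd κ C G) : isRelativeInd κ C (prodLex F G) := by
  obtain ⟨I, _, _, X, x, hI, hC, hx⟩ := isRelativeInd_iff.1 hF
  obtain ⟨J, _, _, Y, y, hJ, hC', hy⟩ := isRelativeInd_iff.1 hG
  have := isFiltered_prod I J
  have : Nonempty I := IsFiltered.nonempty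
  have : Nonempty J := IsFiltered.nonempty
  refine isRelativeInd_prodLex_of_isExhaustion
    (fun h => prop_cokernel_map hC (homOfLE (monotone_fst (leOfHom h))))
    (fun h => prop_cokernel_map hC' (homOfLE (monotone_snd (leOfHom h))))
    (hx.comp (OrderHom.fst : I × J →o I) fun i => ⟨(i, Classical.arbitrary J), le_rfl⟩)
    (hy.comp (OrderHom.snd : I × J →o J) fun j => ⟨(Classical.arbitrary I, j), le_rfl⟩) ?_
  rw [Cardinal.mk_prod, Cardinal.lift_id, Cardinal.lift_id]
  exact (mul_le_mul' hI hJ).trans (Cardinal.mul_eq_self hκ).le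

end Constructions

/-! ### Images and cokernels over a Noetherian pair -/

section Noetherian

variable {D : Type u} [Category.{v} D] [Abelian D] {C : ObjectProperty D}

/-- Over a Noetherian pair, filtered families of subobjects with quotients in `C` stabilise. -/
theorem IsRelativelyNoetherian.exists_stable (hC : IsRelativelyNoetherian C) {X : D} {I : Type v}
    [PartialOrder I] [IsFiltered I] (S : I → Subobject X) (hS : Monotone S)
    (hCS : ∀ {i j : I} (h : i ≤ j), C (cokernel ((S i).ofLE (S j) (hS h)))) :
    ∃ i, ∀ j, i ≤ j → S j = S i := by
  by_contra! h
  choose next hle hne using h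
  have : Nonempty I := IsFiltered.nonempty
  let seq : ℕ → I := fun n => n.rec (Classical.arbitrary I) fun _ i => next i
  have hseq : ∀ n, seq n ≤ seq (n + 1) := fun n => hle (seq n)
  obtain ⟨n, hn⟩ := hC X (fun n => S (seq n)) (hS.comp (monotone_nat_of_le_succ hseq))
    (fun n => hCS (hseq n))
  exact hne _ (hn n le_rfl)

/-- The section `t` of `G` comes, on an epimorphic cover, from a multiple of the section `s` of `F`
along `f`. -/
def LiftsTo {F G : Lex D} (f : F ⟶ G) {A U : D} (s : Sec F A) (t : Sec G U) : Prop :=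
  ∃ (V : D) (p : V ⟶ U) (_ : Epi p) (v : V ⟶ A), sec f V (res F v s) = res G p t

variable [C.IsSerreClass] {F G : Lex D} (f : F ⟶ G) {I J : Type v} [PartialOrder I] [PartialOrder J]
  [IsFiltered J] {X : I ⥤ D} {Y : J ⥤ D} {x : ∀ i, Sec F (X.obj i)} {y : ∀ j, Sec G (Y.obj j)}

/-- The image of `s` in `G` is a morphism `w` into some `Y k` with `k` beyond `j`. Lifting along `f`
thus becomes a question in `D`: a morphism lies locally in the image of `w` exactly when the
cokernel of `w` kills it. -/
theorem IsExhaustion.exists_map (hy : IsExhaustion G Y y) {A : D} (s : Sec F A) (j : J) :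
    ∃ (k : J) (h : j ⟶ k) (w : A ⟶ Y.obj k), ∀ {U : D} (u : U ⟶ Y.obj j),
      (LiftsTo f s (res G u (y j)) ↔ (u ≫ Y.map h) ≫ cokernel.π w = 0) ∧
      ∀ {V : D} (p : V ⟶ U) (v : V ⟶ A),
        sec f V (res F v s) = res G p (res G u (y j)) ↔ p ≫ u ≫ Y.map h = v ≫ w := by
  obtain ⟨k, h, w, hw⟩ := hy.exists_eq_of_le (sec f _ s) j
  have key : ∀ {U : D} (u : U ⟶ Y.obj j) {V : D} (p : V ⟶ U) (v : V ⟶ A),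
        sec f V (res F v s) = res G p (res G u (y j)) ↔ p ≫ u ≫ Y.map h = v ≫ w := by
    intro U u V p v
    rw [sec_res, ← hw, ← res_comp, ← res_comp, ← hy.res_comp_map h, Category.assoc]
    exact ⟨fun h => (hy.eq_of_res_eq h).symm, fun h => by rw [h]⟩
  refine ⟨k, h, w, fun {U} u => ⟨⟨?_, fun hu => ?_⟩, key u⟩⟩
  · rintro ⟨V, p, _, v, hv⟩
    rw [key] at hv
    rw [← cancel_epi p, ← Category.assoc, hv, Category.assoc, cokernel.condition, comp_zero,
      comp_zero]
  · obtain ⟨V, p, hp, v, hv⟩ := (ShortComplex.exact_cokernel w).exact_up_to_refinements _ hu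
    exact ⟨V, p, hp, v, (key u p v).2 hv⟩

theorem exists_subobject_liftsTo (hy : IsExhaustion G Y y) {A : D} (s : Sec F A) (j : J) :
    ∃ S : Subobject (Y.obj j), ∀ {U : D} (u : U ⟶ Y.obj j),
      S.Factors u ↔ LiftsTo f s (res G u (y j)) := by
  obtain ⟨k, h, w, hw⟩ := hy.exists_map f s j
  refine ⟨kernelSubobject (Y.map h ≫ cokernel.π w), fun u => ?_⟩
  rw [kernelSubobject_factors_iff, (hw u).1, Category.assoc]

variable {f}

theorem LiftsTo.of_map (hx : IsExhaustion F X x) {i i' : I} (h : i ⟶ i') {U : D} {t : Sec G U}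
    (ht : LiftsTo f (x i) t) : LiftsTo f (x i') t := by
  obtain ⟨V, p, hp, v, hv⟩ := ht
  exact ⟨V, p, hp, v ≫ X.map h, by rw [hx.res_comp_map, hv]⟩

/-- With `w` the restriction to `X i` of `w' : X i' ⟶ Y k`, the subobjects `A` and `B` are the
preimages in `Y j` of the images of `w` and `w'`. So `B / A` embeds in the image of `X i' / X i` in
the cokernel of `w`, a subquotient of an object of `C`. -/
theorem prop_cokernel_ofLE (hx : IsExhaustion F X x) (hy : IsExhaustion G Y y) {i i' : I}
    (h : i ⟶ i') (hC : C (cokernel (X.map h))) {j : J} {A B : Subobject (Y.obj j)}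
    (hA : ∀ {U : D} (u : U ⟶ Y.obj j), A.Factors u ↔ LiftsTo f (x i) (res G u (y j)))
    (hB : ∀ {U : D} (u : U ⟶ Y.obj j), B.Factors u ↔ LiftsTo f (x i') (res G u (y j)))
    (hAB : A ≤ B) : C (cokernel (A.ofLE B hAB)) := by
  obtain ⟨k, l, w', hw'⟩ := hy.exists_map f (x i') j
  -- Using `w'` for both stages puts the two images in the same `Y k`.
  obtain ⟨w, hw⟩ : ∃ w, w = X.map h ≫ w' := ⟨_, rfl⟩
  have hA' : ∀ {U : D} (u : U ⟶ Y.obj j), A.Factors u ↔ (u ≫ Y.map l) ≫ cokernel.π w = 0 := by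
    intro U u
    rw [hA]
    constructor
    · rintro ⟨V, p, _, v, hv⟩
      rw [← hx.res_comp_map h, (hw' u).2, Category.assoc, ← hw] at hv
      rw [← cancel_epi p, ← Category.assoc, hv, Category.assoc, cokernel.condition, comp_zero,
        comp_zero]
    · intro hu
      obtain ⟨V, p, hp, v, hv⟩ := (ShortComplex.exact_cokernel w).exact_up_to_refinements _ hu
      refine ⟨V, p, hp, v, ?_⟩
      rw [← hx.res_comp_map h, (hw' u).2, Category.assoc, ← hw]
      exact hv
  let m : cokernel (X.map h) ⟶ cokernel w :=
    cokernel.desc _ (w' ≫ cokernel.π w) (by rw [← Category.assoc, ← hw, cokernel.condition])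
  have hm : cokernel.π (X.map h) ≫ m = w' ≫ cokernel.π w := cokernel.π_desc _ _ _
  obtain ⟨V, p, _, v, hv⟩ := (hB B.arrow).1 B.factors_self
  rw [(hw' B.arrow).2] at hv
  have hBm : (B.arrow ≫ Y.map l ≫ cokernel.π w) ≫ cokernel.π m = 0 := by
    rw [← cancel_epi p, comp_zero]
    simp only [Category.assoc]
    rw [reassoc_of% hv, ← reassoc_of% hm, cokernel.condition, comp_zero, comp_zero]
  have hg : kernel.lift (cokernel.π m) _ hBm ≫ kernel.ι (cokernel.π m) =
    B.arrow ≫ Y.map l ≫ cokernel.π w := kernel.lift_ι _ _ _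
  refine prop_cokernel_of_exact _ (kernel.lift (cokernel.π m) _ hBm)
    (C.prop_of_epi (Abelian.factorThruImage m) hC) ?_ ?_
  · rw [← cancel_mono (kernel.ι (cokernel.π m)), Category.assoc, hg, zero_comp,
      Subobject.ofLE_arrow_assoc, ← Category.assoc, ← hA']
    exact A.factors_self
  · intro U u hu
    have hu' := hu =≫ kernel.ι (cokernel.π m)
    rw [Category.assoc, hg, zero_comp, ← Category.assoc, ← Category.assoc, ← hA'] at hu'
    refine ⟨A.factorThru _ hu', ?_⟩
    rw [← cancel_mono B.arrow, Category.assoc, Subobject.ofLE_arrow, Subobject.factorThru_arrow]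

/-- Over a Noetherian pair the local image of `f` meets every `Y j` in a subobject. -/
theorem IsRelativelyNoetherian.exists_subobject_image (hC : IsRelativelyNoetherian C)
    [IsFiltered I] (hCX : ∀ (i j : I) (h : i < j), C (cokernel (X.map (homOfLE h.le))))
    (hx : IsExhaustion F X x) (hy : IsExhaustion G Y y) (j : J) :
    ∃ S : Subobject (Y.obj j), ∀ {U : D} (u : U ⟶ Y.obj j), S.Factors u ↔
      ∃ (V : D) (p : V ⟶ U) (_ : Epi p) (t : Sec F V), sec f V t = res G p (res G u (y j)) := by
  choose S hS using fun i => exists_subobject_liftsTo f hy (x i) j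
  have hmono : Monotone S := fun i i' h => Subobject.le_of_factors
    ((hS i' _).2 (((hS i _).1 (S i).factors_self).of_map hx (homOfLE h)))
  obtain ⟨i, hi⟩ := hC.exists_stable S hmono (fun {i i'} h =>
    prop_cokernel_ofLE hx hy (homOfLE h) (prop_cokernel_map hCX _) (hS i) (hS i') _)
  refine ⟨S i, fun {U} u => ⟨fun hu => ?_, ?_⟩⟩
  · obtain ⟨V, p, hp, v, hv⟩ := (hS i u).1 hu
    exact ⟨V, p, hp, _, hv⟩
  · rintro ⟨V, p, hp, t, ht⟩
    obtain ⟨i', h, v, rfl⟩ := hx.exists_eq_of_le t i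
    rw [← hi i' (leOfHom h)]
    exact (hS i' u).2 ⟨V, p, hp, v, ht⟩

/-- The cokernel is the union of the quotients `Y j / S j`, where `S j` is the part of the local
image of `f` lying in `Y j`. -/
theorem IsRelativelyNoetherian.exists_isLocalCokernel {κ : Cardinal.{v}}
    (hC : IsRelativelyNoetherian C) (hF : isRelativeInd κ C F) (hG : isRelativeInd κ C G)
    (f : F ⟶ G) :
    ∃ (Q : Lex D) (q : G ⟶ Q), isRelativeInd κ C Q ∧ IsLocalCokernel f q := by
  obtain ⟨I, _, _, X, x, -, hCX, hx⟩ := isRelativeInd_iff.1 hF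
  obtain ⟨J, _, _, Y, y, hκ, hCY, hy⟩ := isRelativeInd_iff.1 hG
  choose S hS using hC.exists_subobject_image (f := f) hCX hx hy
  have hfac : ∀ {j : J} {U : D} (u : U ⟶ Y.obj j),
      (S j).Factors u ↔ u ≫ cokernel.π (S j).arrow = 0 := by
    intro j U u
    refine ⟨fun h => ?_, fun h => ?_⟩
    · rw [← Subobject.factorThru_arrow _ _ h, Category.assoc, cokernel.condition, comp_zero]
    · rw [← Abelian.monoLift_comp (S j).arrow u h]
      exact Subobject.factors_comp_arrow _
  -- The preimage of `S j'` in `Y j` is exactly `S j`, since both are defined by the same sections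
  -- of `G`. This makes the transition maps of the quotients monomorphisms.
  have hmap : ∀ {j j' : J} (h : j ⟶ j') {U : D} (u : U ⟶ Y.obj j),
      (S j').Factors (u ≫ Y.map h) ↔ (S j).Factors u := by
    intro j j' h U u
    rw [hS, hS, hy.res_comp_map]
  have hdesc : ∀ {j j' : J} (h : j ⟶ j'),
      (S j).arrow ≫ Y.map h ≫ cokernel.π (S j').arrow = 0 := by
    intro j j' h
    rw [← Category.assoc, ← hfac, hmap]
    exact (S j).factors_self
  let Z : J ⥤ D :=
    { obj := fun j => cokernel (S j).arrow
      map := fun h => cokernel.desc _ _ (hdesc h)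
      map_id := fun j => by
        rw [← cancel_epi (cokernel.π _)]
        simp
      map_comp := fun h h' => by
        rw [← cancel_epi (cokernel.π _)]
        simp }
  have hZ : ∀ {j j' : J} (h : j ⟶ j'),
      cokernel.π (S j).arrow ≫ Z.map h = Y.map h ≫ cokernel.π (S j').arrow :=
    fun h => cokernel.π_desc _ _ _
  have hmono : ∀ {j j' : J} (h : j ⟶ j'), Mono (Z.map h) := by
    intro j j' h
    apply Preadditive.mono_of_cancel_zero
    intro U v hv
    obtain ⟨V, p, _, u, hu⟩ := surjective_up_to_refinements_of_epi (cokernel.π (S j).arrow) v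
    have h₀ : (S j).Factors u := by
      rw [← hmap h, hfac, Category.assoc, ← hZ, ← Category.assoc]
      exact (congrArg (· ≫ Z.map h) hu.symm).trans (by simp only [Category.assoc, hv, comp_zero])
    rw [hfac] at h₀
    rw [← cancel_epi p, comp_zero]
    exact hu.trans h₀
  obtain ⟨Q, z, hz⟩ := exists_isExhaustion hmono
  obtain ⟨q, hq⟩ := hy.exists_desc (fun j => res Q (cokernel.π (S j).arrow) (z j))
    (fun {j j'} h => by
      rw [← res_comp]
      exact (congrArg (fun t => res Q t (z j')) (hZ h)).symm.trans (hz.res_comp_map h _))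
  have hq' : ∀ {j : J} {U : D} (u : U ⟶ Y.obj j),
      sec q U (res G u (y j)) = 0 ↔ (S j).Factors u := by
    intro j U u
    rw [sec_res, hq, ← res_comp, hfac]
    exact ⟨hz.eq_zero _, fun h => (congrArg (fun t => res Q t (z j)) h).trans (res_zero Q _)⟩
  refine ⟨Q, q, isRelativeInd_iff.2 ⟨J, _, inferInstance, Z, z, hκ, fun j j' h => ?_, hz⟩, ?_⟩
  · let m : cokernel (Y.map (homOfLE h.le)) ⟶ cokernel (Z.map (homOfLE h.le)) :=
      cokernel.map _ _ (cokernel.π (S j).arrow) (cokernel.π (S j').arrow) (hZ _).symm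
    have hm : cokernel.π (Y.map (homOfLE h.le)) ≫ m =
        cokernel.π (S j').arrow ≫ cokernel.π (Z.map (homOfLE h.le)) := cokernel.π_desc _ _ _
    have : Epi m := epi_of_epi_fac hm
    exact C.prop_of_epi m (hCY j j' h)
  · refine ⟨lex_hom_ext fun U t => ?_, fun {U} s => ?_, fun {U} s hs => ?_⟩
    · obtain ⟨j, u, hu⟩ := hy.exists_eq (sec f U t)
      rw [sec_comp, ← hu, sec_zero, hq', hS]
      exact ⟨U, 𝟙 U, inferInstance, t, by rw [hu, res_id]⟩
    · obtain ⟨j, v, rfl⟩ := hz.exists_eq s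
      obtain ⟨V, p, hp, u, hu⟩ := surjective_up_to_refinements_of_epi (cokernel.π (S j).arrow) v
      refine ⟨V, p, hp, res G u (y j), ?_⟩
      rw [sec_res, hq, ← res_comp, ← res_comp]
      exact congrArg (fun t => res Q t (z j)) hu.symm
    · obtain ⟨j, u, rfl⟩ := hy.exists_eq s
      rwa [hq', hS] at hs

end Noetherian

/-! ### The abelian structure, and the converse -/

section AbelianStructure

variable {D : Type u} [Category.{v} D] [Abelian D]

theorem IsSectionKernel.isLimit {K F G : Lex D} {k : K ⟶ F} {f : F ⟶ G}
    (h : IsSectionKernel k f) : Nonempty (IsLimit (KernelFork.ofι k h.comp)) := by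
  choose l hl using fun {T : Lex D} (t : T ⟶ F) (ht : t ≫ f = 0) => h.exists_lift t ht
  exact ⟨KernelFork.IsLimit.ofι _ _ l hl
    fun t ht m hm => h.hom_ext (by rw [hm, hl])⟩

theorem IsLocalCokernel.isColimit {F G Q : Lex D} {f : F ⟶ G} {q : G ⟶ Q}
    (h : IsLocalCokernel f q) : Nonempty (IsColimit (CokernelCofork.ofπ q h.comp)) := by
  choose l hl using fun {T : Lex D} (t : G ⟶ T) (ht : f ≫ t = 0) => h.exists_desc t ht
  exact ⟨CokernelCofork.IsColimit.ofπ _ _ l hl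
    fun t ht m hm => h.hom_ext (by rw [hm, hl])⟩

/-- A categorical kernel is a kernel on sections if there is a kernel on sections. -/
theorem IsSectionKernel.of_comparison {K K' F G : Lex D} {k' : K' ⟶ F} {f : F ⟶ G}
    (h : IsSectionKernel k' f) {k : K ⟶ F} (hk : k ≫ f = 0) (l : K' ⟶ K) (hl : l ≫ k = k')
    (hk' : ∀ e : K ⟶ K, e ≫ k = k → e = 𝟙 K) : IsSectionKernel k f := by
  obtain ⟨m, hm⟩ := h.exists_lift k hk
  have hml : m ≫ l = 𝟙 K := hk' _ (by rw [Category.assoc, hl, hm])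
  refine ⟨hk, fun U a b hab => ?_, fun {U} s hs => ?_⟩
  · have h₁ : sec m U a = sec m U b := h.injective U (by rw [← sec_comp, ← sec_comp, hm, hab])
    rw [← sec_id K a, ← sec_id K b, ← hml, sec_comp, sec_comp, h₁]
  · obtain ⟨t, rfl⟩ := h.exists_eq s hs
    exact ⟨sec l U t, by rw [← sec_comp, hl]⟩

/-- A categorical cokernel is a local cokernel if there is a local cokernel. -/
theorem IsLocalCokernel.of_comparison {F G Q Q' : Lex D} {f : F ⟶ G} {q' : G ⟶ Q'}
    (h : IsLocalCokernel f q') {q : G ⟶ Q} (hq : f ≫ q = 0) (l : Q ⟶ Q') (hl : q ≫ l = q')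
    (hq' : ∀ e : Q ⟶ Q, q ≫ e = q → e = 𝟙 Q) : IsLocalCokernel f q := by
  obtain ⟨m, hm⟩ := h.exists_desc q hq
  have hlm : l ≫ m = 𝟙 Q := hq' _ (by rw [← Category.assoc, hl, hm])
  refine ⟨hq, fun {U} s => ?_, fun {U} s hs => h.exists_eq s ?_⟩
  · obtain ⟨V, p, hp, t, ht⟩ := h.exists_lift (sec l U s)
    exact ⟨V, p, hp, t, by rw [← hm, sec_comp, ht, sec_res, ← sec_comp, hlm, sec_id]⟩
  · rw [← hl, sec_comp, hs, map_zero]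

variable {κ : Cardinal.{v}} {C : ObjectProperty D}

theorem relInd_hom_ext {F G : RelInd κ C} {f g : F ⟶ G} (h : f.hom = g.hom) : f = g :=
  ObjectProperty.hom_ext _ h

theorem isLimit_of_isSectionKernel {K F G : RelInd κ C} {k : K ⟶ F} {f : F ⟶ G}
    (h : IsSectionKernel k.hom f.hom) (w : k ≫ f = 0) :
    Nonempty (IsLimit (KernelFork.ofι k w)) := by
  choose l hl using fun {T : RelInd κ C} (t : T ⟶ F) (ht : t ≫ f = 0) =>
    h.exists_lift t.hom (congrArg (fun m => m.hom) ht)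
  exact ⟨KernelFork.IsLimit.ofι _ _ (fun t ht => ObjectProperty.homMk (l t ht))
    (fun t ht => relInd_hom_ext (hl t ht))
    (fun t ht m hm => relInd_hom_ext (h.hom_ext ((congrArg (fun m => m.hom) hm).trans
      (hl t ht).symm)))⟩

theorem isColimit_of_isLocalCokernel {F G Q : RelInd κ C} {f : F ⟶ G} {q : G ⟶ Q}
    (h : IsLocalCokernel f.hom q.hom) (w : f ≫ q = 0) :
    Nonempty (IsColimit (CokernelCofork.ofπ q w)) := by
  choose l hl using fun {T : RelInd κ C} (t : G ⟶ T) (ht : f ≫ t = 0) =>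
    h.exists_desc t.hom (congrArg (fun m => m.hom) ht)
  exact ⟨CokernelCofork.IsColimit.ofπ _ _ (fun t ht => ObjectProperty.homMk (l t ht))
    (fun t ht => relInd_hom_ext (hl t ht))
    (fun t ht m hm => relInd_hom_ext (h.hom_ext ((congrArg (fun m => m.hom) hm).trans
      (hl t ht).symm)))⟩

variable [C.IsSerreClass]

theorem RelInd.exists_kernel {F G : RelInd κ C} (f : F ⟶ G) :
    ∃ (K : RelInd κ C) (k : K ⟶ F) (_ : k ≫ f = 0), IsSectionKernel k.hom f.hom := by
  obtain ⟨K, k, hK, hk⟩ := exists_isSectionKernel F.property G.property f.hom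
  exact ⟨⟨K, hK⟩, ObjectProperty.homMk k, relInd_hom_ext hk.comp, hk⟩

theorem RelInd.exists_cokernel (hC : IsRelativelyNoetherian C) {F G : RelInd κ C} (f : F ⟶ G) :
    ∃ (Q : RelInd κ C) (q : G ⟶ Q) (_ : f ≫ q = 0), IsLocalCokernel f.hom q.hom := by
  obtain ⟨Q, q, hQ, hq⟩ := hC.exists_isLocalCokernel F.property G.property f.hom
  exact ⟨⟨Q, hQ⟩, ObjectProperty.homMk q, relInd_hom_ext hq.comp, hq⟩

/-- The kernel on sections belongs to `Ind`, so the monomorphism can be cancelled against it. -/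
theorem RelInd.injective_of_mono {F G : RelInd κ C} (f : F ⟶ G) [Mono f] (U : D) :
    Function.Injective (sec f.hom U) := by
  obtain ⟨K, k, w, hk⟩ := RelInd.exists_kernel f
  have h₀ : k = 0 := by rwa [← cancel_mono f, zero_comp]
  rw [injective_iff_map_eq_zero]
  intro s hs
  obtain ⟨t, rfl⟩ := hk.exists_eq s hs
  rw [h₀]
  rfl

theorem RelInd.locallySurjective_of_epi (hC : IsRelativelyNoetherian C) {F G : RelInd κ C}
    (f : F ⟶ G) [Epi f] {U : D} (s : Sec G.obj U) :
    ∃ (V : D) (p : V ⟶ U) (_ : Epi p) (t : Sec F.obj V), sec f.hom V t = res G.obj p s := by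
  obtain ⟨Q, q, w, hq⟩ := RelInd.exists_cokernel hC f
  have h₀ : q = 0 := by rwa [← cancel_epi f, comp_zero]
  exact hq.exists_eq s (by rw [h₀]; rfl)

theorem RelInd.hasFiniteProducts (hκ : Cardinal.aleph0 ≤ κ) : HasFiniteProducts (RelInd κ C) := by
  have hz : HasZeroObject (RelInd κ C) := by
    refine ⟨⟨⟨(yonedaLex D).obj 0, isRelativeInd_yonedaLex hκ C 0⟩, ?_⟩⟩
    rw [IsZero.iff_id_eq_zero]
    apply relInd_hom_ext
    apply lex_hom_ext
    intro U (u : U ⟶ 0)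
    exact (isZero_zero D).eq_of_tgt _ _
  have hb : HasBinaryBiproducts (RelInd κ C) := ⟨fun F G => by
    let P : RelInd κ C := ⟨prodLex F.obj G.obj, isRelativeInd_prodLex hκ F.property G.property⟩
    let b : BinaryBicone F G :=
      { pt := P
        fst := ObjectProperty.homMk (lexHomMk (F := P.obj)
          (fun U => AddMonoidHom.fst (Sec F.obj U) (Sec G.obj U)) (fun _ _ => rfl))
        snd := ObjectProperty.homMk (lexHomMk (F := P.obj)
          (fun U => AddMonoidHom.snd (Sec F.obj U) (Sec G.obj U)) (fun _ _ => rfl))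
        inl := ObjectProperty.homMk (lexHomMk (G := P.obj)
          (fun U => AddMonoidHom.inl (Sec F.obj U) (Sec G.obj U))
          (fun u _ => Prod.ext rfl (map_zero (res G.obj u)).symm))
        inr := ObjectProperty.homMk (lexHomMk (G := P.obj)
          (fun U => AddMonoidHom.inr (Sec F.obj U) (Sec G.obj U))
          (fun u _ => Prod.ext (map_zero (res F.obj u)).symm rfl))
        inl_fst := rfl
        inl_snd := rfl
        inr_fst := rfl
        inr_snd := rfl }
    refine hasBinaryBiproduct_of_total b ?_
    apply relInd_hom_ext
    apply lex_hom_ext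
    intro U s
    exact Prod.ext (add_zero s.1) (zero_add s.2)⟩
  have := hasBinaryProducts_of_hasBinaryBiproducts (C := RelInd κ C)
  have := hz.hasTerminal
  exact hasFiniteProducts_of_has_binary_and_terminal

/-- Over a Noetherian pair the relative Ind objects form an abelian category. -/
@[reducible]
noncomputable def RelInd.abelian (hκ : Cardinal.aleph0 ≤ κ) (hC : IsRelativelyNoetherian C) :
    Abelian (RelInd κ C) where
  normalMonoOfMono {F G} f _ := by
    obtain ⟨Q, q, w, hq⟩ := RelInd.exists_cokernel hC f
    obtain ⟨h⟩ := isLimit_of_isSectionKernel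
      (hq.isSectionKernel (RelInd.injective_of_mono f)) w
    exact ⟨⟨Q, q, w, h⟩⟩
  normalEpiOfEpi {F G} f _ := by
    obtain ⟨K, k, w, hk⟩ := RelInd.exists_kernel f
    obtain ⟨h⟩ := isColimit_of_isLocalCokernel
      (hk.isLocalCokernel (RelInd.locallySurjective_of_epi hC f)) w
    exact ⟨⟨K, k, w, h⟩⟩
  has_finite_products := RelInd.hasFiniteProducts hκ
  has_kernels := ⟨fun f => by
    obtain ⟨K, k, w, hk⟩ := RelInd.exists_kernel f
    obtain ⟨h⟩ := isLimit_of_isSectionKernel hk w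
    exact ⟨⟨_, h⟩⟩⟩
  has_cokernels := ⟨fun f => by
    obtain ⟨Q, q, w, hq⟩ := RelInd.exists_cokernel hC f
    obtain ⟨h⟩ := isColimit_of_isLocalCokernel hq w
    exact ⟨⟨_, h⟩⟩⟩

/-- Both sides amount to `S.f` being a kernel of `S.g` on sections and `S.g` a local cokernel of
`S.f`. Comparison with the constructed kernel and cokernel, which are valid in `Lex D` and in `Ind`
alike, gives each translation. -/
theorem RelInd.conflations_iff (hκ : Cardinal.aleph0 ≤ κ) (hC : IsRelativelyNoetherian C)
    (S : ShortComplex (RelInd κ C)) :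
    RelInd.conflations κ C S ↔ @ShortComplex.ShortExact _ _
      (RelInd.abelian hκ hC).toPreadditive.preadditiveHasZeroMorphisms S := by
  let := RelInd.abelian hκ hC
  obtain ⟨K, k, w, hk⟩ := RelInd.exists_kernel S.g
  obtain ⟨Q, q, w', hq⟩ := RelInd.exists_cokernel hC S.f
  constructor
  · rintro ⟨⟨hf⟩, ⟨hg⟩⟩
    have hf' : IsSectionKernel S.f.hom S.g.hom := by
      refine hk.of_comparison (congrArg (fun m => m.hom) S.zero)
        (hf.lift (KernelFork.ofι k.hom (congrArg (fun m => m.hom) w)))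
        (hf.fac (KernelFork.ofι k.hom (congrArg (fun m => m.hom) w)) WalkingParallelPair.zero)
        fun e he => Fork.IsLimit.hom_ext hf (he.trans (Category.id_comp _).symm)
    have hg' : IsLocalCokernel S.f.hom S.g.hom := by
      refine hq.of_comparison (congrArg (fun m => m.hom) S.zero)
        (hg.desc (CokernelCofork.ofπ q.hom (congrArg (fun m => m.hom) w')))
        (hg.fac (CokernelCofork.ofπ q.hom (congrArg (fun m => m.hom) w')) WalkingParallelPair.one)
        fun e he => Cofork.IsColimit.hom_ext hg (he.trans (Category.comp_id _).symm)
    obtain ⟨h⟩ := isLimit_of_isSectionKernel hf' S.zero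
    exact
      { exact := S.exact_of_f_is_kernel h
        mono_f := ⟨fun a b hab => relInd_hom_ext (hf'.hom_ext (congrArg (fun m => m.hom) hab))⟩
        epi_g := ⟨fun a b hab => relInd_hom_ext (hg'.hom_ext (congrArg (fun m => m.hom) hab))⟩ }
  · intro hS
    have := hS.mono_f
    have := hS.epi_g
    have hf' : IsSectionKernel S.f.hom S.g.hom := by
      refine hk.of_comparison (congrArg (fun m => m.hom) S.zero)
        (hS.exact.lift k w).hom (congrArg (fun m => m.hom) (hS.exact.lift_f k w)) fun e he => ?_
      have h : ObjectProperty.homMk e = 𝟙 S.X₁ := by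
        rw [← cancel_mono S.f]
        exact relInd_hom_ext (he.trans (Category.id_comp _).symm)
      exact congrArg (fun m => m.hom) h
    have hg' : IsLocalCokernel S.f.hom S.g.hom := by
      refine hq.of_comparison (congrArg (fun m => m.hom) S.zero)
        (hS.exact.desc q w').hom (congrArg (fun m => m.hom) (hS.exact.g_desc q w')) fun e he => ?_
      have h : ObjectProperty.homMk e = 𝟙 S.X₃ := by
        rw [← cancel_epi S.g]
        exact relInd_hom_ext (he.trans (Category.comp_id _).symm)
      exact congrArg (fun m => m.hom) h
    exact ⟨hf'.isLimit, hg'.isColimit⟩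

theorem RelInd.isEquivalentToAbelian (hκ : Cardinal.aleph0 ≤ κ) (hC : IsRelativelyNoetherian C) :
    IsEquivalentToAbelian (RelInd.conflations κ C) :=
  ⟨RelInd κ C, inferInstance, RelInd.abelian hκ hC, CategoryTheory.Equivalence.refl,
    inferInstanceAs (Functor.Additive (𝟭 (RelInd κ C))), RelInd.conflations_iff hκ hC⟩

/-- In an exact category equivalent to an abelian one, monomorphisms are inflations. -/
theorem IsEquivalentToAbelian.exists_conflation {E : Type w₁} [Category.{w₂} E] [Preadditive E]
    {W : ObjectProperty (ShortComplex E)} (hW : IsEquivalentToAbelian W) {F G : E} (i : F ⟶ G)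
    [Mono i] : ∃ (Q : E) (q : G ⟶ Q) (w : i ≫ q = 0), W (ShortComplex.mk i q w) := by
  obtain ⟨A, _, _, e, _, he⟩ := hW
  let c : e.functor.obj G ⟶ cokernel (e.functor.map i) := cokernel.π _
  let φ := e.functor.objObjPreimageIso (cokernel (e.functor.map i))
  let q : G ⟶ e.functor.objPreimage (cokernel (e.functor.map i)) := e.functor.preimage (c ≫ φ.inv)
  have hq : e.functor.map q = c ≫ φ.inv := e.functor.map_preimage _
  have w : i ≫ q = 0 := by
    apply e.functor.map_injective
    rw [Functor.map_comp, hq, Functor.map_zero, ← Category.assoc, cokernel.condition, zero_comp]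
  refine ⟨_, q, w, (he _).2 ?_⟩
  have hS : (ShortComplex.mk _ _ (cokernel.condition (e.functor.map i))).ShortExact :=
    { exact := ShortComplex.exact_cokernel _
      mono_f := inferInstanceAs (Mono (e.functor.map i))
      epi_g := inferInstanceAs (Epi (cokernel.π (e.functor.map i))) }
  refine ShortComplex.shortExact_of_iso (S₁ := ShortComplex.mk _ _ (cokernel.condition _))
    (S₂ := (ShortComplex.mk i q w).map e.functor) (ShortComplex.isoMk (Iso.refl _) (Iso.refl _) φ.symm ?_ ?_) hS
  · exact (Category.id_comp _).trans (Category.comp_id _).symm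
  · exact (Category.id_comp _).trans hq

/-- The chain condition only controls consecutive quotients, whereas an Ind diagram needs all of
them. By induction, `f (m + 1) / f n` is an extension built from `f m / f n` and `f (m + 1) / f m`.
-/
theorem prop_cokernel_ofLE_of_le {X : D} {f : ℕ → Subobject X} (hf : Monotone f)
    (hC : ∀ n, C (cokernel ((f n).ofLE (f (n + 1)) (hf n.le_succ)))) {n m : ℕ} (h : n ≤ m) :
    C (cokernel ((f n).ofLE (f m) (hf h))) := by
  induction m, h using Nat.le_induction with
  | base =>
    rw [Subobject.ofLE_refl]
    exact prop_cokernel_of_epi _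
  | succ m h ih =>
    let a := (f n).ofLE (f m) (hf h)
    let b := (f m).ofLE (f (m + 1)) (hf m.le_succ)
    have hab : a ≫ b = (f n).ofLE (f (m + 1)) (hf (h.trans m.le_succ)) :=
      Subobject.ofLE_comp_ofLE _ _ _ _ _
    rw [← hab]
    have hw : cokernel.map a (a ≫ b) (𝟙 _) b (by simp) ≫
      cokernel.map (a ≫ b) b a (𝟙 _) (by simp) = 0 := by
        rw [← cancel_epi (cokernel.π _)]
        simp
    refine C.prop_X₂_of_exact (S := ShortComplex.mk _ _ hw) ?_ ih (hC m)
    rw [ShortComplex.exact_iff_exact_up_to_refinements]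
    intro U u hu
    change U ⟶ cokernel (a ≫ b) at u
    change u ≫ cokernel.map (a ≫ b) b a (𝟙 _) (by simp) = 0 at hu
    obtain ⟨V, p, hp, v, hv⟩ := surjective_up_to_refinements_of_epi (cokernel.π (a ≫ b)) u
    have h₀ : v ≫ cokernel.π b = 0 := by
      have := p ≫= hu
      rw [← Category.assoc, hv] at this
      simpa using this
    obtain ⟨V', p', hp', v', hv'⟩ :=
      (ShortComplex.exact_cokernel b).exact_up_to_refinements v h₀
    refine ⟨V', p' ≫ p, inferInstance, v' ≫ cokernel.π a, ?_⟩
    change (p' ≫ p) ≫ u = (v' ≫ cokernel.π a) ≫ cokernel.map a (a ≫ b) (𝟙 _) b (by simp)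
    have hv'' : p' ≫ v = v' ≫ b := hv'
    rw [Category.assoc, hv, ← Category.assoc, hv'', Category.assoc, Category.assoc,
      cokernel.π_desc]

omit [C.IsSerreClass] in
/-- If `Ind_κ(D, C)` is abelian, then a filtered family of subobjects with quotients in `C` has a
largest element. -/
theorem IsEquivalentToAbelian.exists_forall_factor (hκ : Cardinal.aleph0 ≤ κ)
    (h : IsEquivalentToAbelian (RelInd.conflations κ C)) {I : Type v} [PartialOrder I]
    [IsFiltered I] (hI : Cardinal.mk I ≤ κ) {Y : I ⥤ D}
    (hC : ∀ (i j : I) (h : i < j), C (cokernel (Y.map (homOfLE h.le)))) {X : D}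
    (a : ∀ i, Y.obj i ⟶ X) [∀ i, Mono (a i)] (ha : ∀ {i j : I} (h : i ⟶ j), Y.map h ≫ a j = a i) :
    ∃ i, ∀ j, ∃ u : Y.obj j ⟶ Y.obj i, u ≫ a i = a j := by
  obtain ⟨F, x, hx⟩ := exists_isExhaustion fun h => mono_of_mono_fac (ha h)
  obtain ⟨i, hi⟩ := hx.exists_desc (G := (yonedaLex D).obj X) a ha
  have hi' : ∀ {n : I} {U : D} (u : U ⟶ Y.obj n), sec i U (res F u (x n)) = (u ≫ a n : U ⟶ X) := by
    intro n U u
    rw [sec_res, hi]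
    rfl
  have hF : isRelativeInd κ C F :=
    isRelativeInd_iff.2 ⟨_, _, inferInstance, Y, x, hI, hC, hx⟩
  have hinj : ∀ U, Function.Injective (sec i U) := by
    intro U
    rw [injective_iff_map_eq_zero]
    intro s hs
    obtain ⟨n, u, rfl⟩ := hx.exists_eq s
    have hs' : u ≫ a n = 0 := (hi' u).symm.trans hs
    rw [← zero_comp (f := a n), cancel_mono] at hs'
    rw [hs', res_zero]
  let FE : RelInd κ C := ⟨F, hF⟩
  let XE : RelInd κ C := ⟨(yonedaLex D).obj X, isRelativeInd_yonedaLex hκ C X⟩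
  let iE : FE ⟶ XE := ObjectProperty.homMk i
  have : Mono iE := ⟨fun {T} a b hab => relInd_hom_ext (lex_hom_ext fun U s =>
    hinj U (congrArg (fun m => sec m.hom U s) hab))⟩
  -- Only the kernel half of the conflation is used: the union `F` is the kernel in `Lex D` of a map
  -- out of `X`.
  obtain ⟨Q, q, w, ⟨hker⟩, -⟩ := h.exists_conflation iE
  obtain ⟨J, _, _, Z, z, -, -, hz⟩ := isRelativeInd_iff.1 Q.property
  let r : (yonedaLex D).obj X ⟶ Q.obj := q.hom
  have hir : i ≫ r = 0 := congrArg (fun m => m.hom) w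
  -- By Yoneda the map from `X` is a section of a union, hence a single morphism `v : X ⟶ Z j` of
  -- `D`, with the same kernel.
  obtain ⟨j, v, hv⟩ := hz.exists_eq (sec r X (𝟙 X))
  have hr : ∀ {U : D} (u : U ⟶ X), sec r U u = 0 ↔ u ≫ v = 0 := by
    intro U u
    rw [sec_of_yonedaLex r u, ← hv, ← res_comp]
    exact ⟨hz.eq_zero _, fun h => by rw [h, res_zero]⟩
  have hk : (yonedaLex D).map (kernel.ι v) ≫ r = 0 := by
    apply lex_hom_ext
    intro U (u : U ⟶ kernel v)
    exact (hr (u ≫ kernel.ι v)).2 (by rw [Category.assoc, kernel.condition, comp_zero])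
  let l : (yonedaLex D).obj (kernel v) ⟶ F := hker.lift (KernelFork.ofι _ hk)
  have hl : l ≫ i = (yonedaLex D).map (kernel.ι v) :=
    hker.fac (KernelFork.ofι _ hk) WalkingParallelPair.zero
  -- The inclusion of the kernel of `v` is a section of the union `F`, so it factors through one
  -- stage `n`. Every `a m` factors through this kernel, hence through `a n`.
  obtain ⟨n, u, hu⟩ := hx.exists_eq (sec l _ (𝟙 (kernel v)))
  have hun : u ≫ a n = kernel.ι v := by
    rw [← hi', hu]
    exact (congrArg (fun m => sec m (kernel v) (𝟙 (kernel v))) hl).trans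
      (Category.id_comp (kernel.ι v))
  refine ⟨n, fun m => ⟨kernel.lift v (a m) ?_ ≫ u, ?_⟩⟩
  · rw [← hr, ← hi m, ← sec_comp, hir, sec_zero]
  · rw [Category.assoc, hun, kernel.lift_ι]

theorem isRelativelyNoetherian_of_isEquivalentToAbelian (hκ : Cardinal.aleph0 ≤ κ)
    (h : IsEquivalentToAbelian (RelInd.conflations κ C)) : IsRelativelyNoetherian C := by
  intro X f hf hC
  have hmono : Monotone fun n : ULift.{v} ℕ => f n.down := fun i j h => hf h
  have (n : ULift.{v} ℕ) : Mono (C := D)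
      (X := (hmono.functor ⋙ Subobject.underlying).obj n) (f n.down).arrow :=
    inferInstanceAs (Mono (f n.down).arrow)
  obtain ⟨n, hn⟩ := h.exists_forall_factor hκ (I := ULift.{v} ℕ) (by simpa using hκ)
    (Y := hmono.functor ⋙ Subobject.underlying)
    (fun i j h => prop_cokernel_ofLE_of_le hf hC h.le) (X := X) (fun n => (f n.down).arrow)
    (fun h => Subobject.underlying_arrow _)
  have hle : ∀ m, f m ≤ f n.down := by
    intro m
    obtain ⟨u, hu⟩ := hn ⟨m⟩
    exact Subobject.le_of_comm u hu
  exact ⟨n.down, fun m hm => le_antisymm ((hle _).trans (hf hm)) (hf m.le_succ)⟩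

theorem RelInd.isEquivalentToAbelian_iff (C : ObjectProperty D) [C.IsSerreClass]
    (hκ : Cardinal.aleph0 ≤ κ) :
    IsEquivalentToAbelian (RelInd.conflations κ C) ↔ IsRelativelyNoetherian C :=
  ⟨isRelativelyNoetherian_of_isEquivalentToAbelian hκ, RelInd.isEquivalentToAbelian hκ⟩

end AbelianStructure

/-! ### Passage to the opposite category -/

section Duality

instance isSerreClass_op {D : Type u} [Category.{v} D] [Abelian D] (C : ObjectProperty D)
    [C.IsSerreClass] : C.op.IsSerreClass where
  prop_of_mono f _ h := C.prop_of_epi f.unop h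
  prop_of_epi f _ h := C.prop_of_mono f.unop h
  prop_X₂_of_shortExact hS h₁ h₃ := C.prop_X₂_of_shortExact hS.unop h₃ h₁

theorem isEquivalentToAbelian_op_iff {E : Type w₁} [Category.{w₂} E] [Preadditive E]
    {W : ObjectProperty (ShortComplex E)} {W' : ObjectProperty (ShortComplex Eᵒᵖ)}
    (hW : ∀ S, W' S ↔ W S.unop) : IsEquivalentToAbelian W' ↔ IsEquivalentToAbelian W := by
  constructor
  · rintro ⟨A, _, _, e, he, h⟩
    have : e.rightOp.functor.Additive := ⟨fun {X Y f g} => by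
      apply Quiver.Hom.unop_inj
      exact e.functor.map_add (f := f.op) (g := g.op)⟩
    refine ⟨Aᵒᵖ, inferInstance, inferInstance, e.rightOp, this, fun S => ?_⟩
    have h₁ : W S ↔ W' S.op := (hW S.op).symm
    rw [h₁, h, ShortComplex.shortExact_iff_op]
    rfl
  · rintro ⟨A, _, _, e, he, h⟩
    have : e.op.functor.Additive := inferInstanceAs e.functor.op.Additive
    refine ⟨Aᵒᵖ, inferInstance, inferInstance, e.op, this, fun S => ?_⟩
    rw [hW, h, ShortComplex.shortExact_iff_op]
    rfl

variable {D : Type u} [Category.{v} D] [Abelian D]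

/-- The subobject `T` of `Y` in `Dᵒᵖ` is the quotient of `Y` by `S` in `D`. -/
def IsDual {Y : Dᵒᵖ} (S : Subobject Y.unop) (T : Subobject Y) : Prop :=
  ∃ w : S.arrow ≫ T.arrow.unop = 0, (ShortComplex.mk _ _ w).ShortExact

theorem exists_isDual_right {Y : Dᵒᵖ} (S : Subobject Y.unop) : ∃ T : Subobject Y, IsDual S T := by
  let φ := Subobject.underlyingIso (cokernel.π S.arrow).op
  have h : cokernel.π S.arrow ≫ φ.hom.unop =
      (Subobject.mk (cokernel.π S.arrow).op).arrow.unop :=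
    congrArg Quiver.Hom.unop (Subobject.underlyingIso_hom_comp_eq_mk (cokernel.π S.arrow).op)
  have w : S.arrow ≫ (Subobject.mk (cokernel.π S.arrow).op).arrow.unop = 0 := by
    rw [← h, ← Category.assoc, cokernel.condition, zero_comp]
  refine ⟨Subobject.mk (cokernel.π S.arrow).op, w, ?_⟩
  exact ShortComplex.shortExact_of_iso
    (S₁ := ShortComplex.mk _ _ (cokernel.condition S.arrow)) (S₂ := ShortComplex.mk _ _ w)
    (ShortComplex.isoMk (Iso.refl _) (Iso.refl _) φ.unop
      ((Category.id_comp _).trans (Category.comp_id _).symm) ((Category.id_comp _).trans h.symm))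
    { exact := ShortComplex.exact_cokernel _
      mono_f := inferInstanceAs (Mono S.arrow)
      epi_g := inferInstanceAs (Epi (cokernel.π S.arrow)) }

theorem exists_isDual_left {Y : Dᵒᵖ} (T : Subobject Y) : ∃ S : Subobject Y.unop, IsDual S T := by
  let φ := Subobject.underlyingIso (kernel.ι T.arrow.unop)
  have h : φ.hom ≫ kernel.ι T.arrow.unop = (Subobject.mk (kernel.ι T.arrow.unop)).arrow :=
    Subobject.underlyingIso_hom_comp_eq_mk _
  have w : (Subobject.mk (kernel.ι T.arrow.unop)).arrow ≫ T.arrow.unop = 0 := by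
    rw [← h, Category.assoc, kernel.condition, comp_zero]
  refine ⟨Subobject.mk (kernel.ι T.arrow.unop), w, ?_⟩
  exact ShortComplex.shortExact_of_iso
    (S₁ := ShortComplex.mk _ _ (kernel.condition T.arrow.unop)) (S₂ := ShortComplex.mk _ _ w)
    (ShortComplex.isoMk φ.symm (Iso.refl _) (Iso.refl _)
      ((congrArg (φ.inv ≫ ·) h.symm).trans
        ((φ.inv_hom_id_assoc _).trans (Category.comp_id _).symm))
      ((Category.id_comp _).trans (Category.comp_id _).symm))
    { exact := ShortComplex.exact_kernel _
      mono_f := inferInstanceAs (Mono (kernel.ι T.arrow.unop))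
      epi_g := inferInstanceAs (Epi T.arrow.unop) }

theorem IsDual.le_iff {Y : Dᵒᵖ} {S S' : Subobject Y.unop} {T T' : Subobject Y} (h : IsDual S T)
    (h' : IsDual S' T') : S ≤ S' ↔ T' ≤ T := by
  obtain ⟨w, h⟩ := h
  obtain ⟨w', h'⟩ := h'
  have := h.epi_g
  have := h'.mono_f
  constructor
  · intro hS
    have h₀ : S.arrow ≫ T'.arrow.unop = 0 := by
      rw [← Subobject.ofLE_arrow hS, Category.assoc, w', comp_zero]
    refine Subobject.le_of_comm (h.exact.desc T'.arrow.unop h₀).op ?_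
    exact congrArg Quiver.Hom.op (h.exact.g_desc T'.arrow.unop h₀)
  · intro hT
    have h₀ : S.arrow ≫ T'.arrow.unop = 0 := by
      rw [← Subobject.ofLE_arrow hT, unop_comp, reassoc_of% w, zero_comp]
    exact Subobject.le_of_comm (h'.exact.lift S.arrow h₀) (h'.exact.lift_f S.arrow h₀)

theorem IsDual.eq_iff {Y : Dᵒᵖ} {S S' : Subobject Y.unop} {T T' : Subobject Y} (h : IsDual S T)
    (h' : IsDual S' T') : S = S' ↔ T = T' := by
  rw [le_antisymm_iff, le_antisymm_iff, h.le_iff h', h'.le_iff h, and_comm]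

/-- In `D` the objects `T` and `T'` are the quotients `Y / S` and `Y / S'`, and `S' / S` is the
kernel of `t : Y / S ⟶ Y / S'`. Here `c : S' ⟶ kernel t` is an epimorphism with kernel `S`, so each
direction is a closure property of `C`. -/
theorem IsDual.prop_cokernel_iff (C : ObjectProperty D) [C.IsSerreClass] {Y : Dᵒᵖ}
    {S S' : Subobject Y.unop} {T T' : Subobject Y} (h : IsDual S T) (h' : IsDual S' T')
    (hS : S ≤ S') (hT : T' ≤ T) :
    C (cokernel (S.ofLE S' hS)) ↔ C.op (cokernel (T'.ofLE T hT)) := by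
  obtain ⟨w, h⟩ := h
  obtain ⟨w', h'⟩ := h'
  have := h.epi_g
  have := h.mono_f
  have := h'.mono_f
  let t := (T'.ofLE T hT).unop
  have ht : T.arrow.unop ≫ t = T'.arrow.unop := congrArg Quiver.Hom.unop (Subobject.ofLE_arrow hT)
  have h₀ : (S'.arrow ≫ T.arrow.unop) ≫ t = 0 := by rw [Category.assoc, ht, w']
  let c : (S' : D) ⟶ kernel t := kernel.lift t _ h₀
  have hc : c ≫ kernel.ι t = S'.arrow ≫ T.arrow.unop := kernel.lift_ι _ _ _
  have hepi : Epi c := by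
    rw [epi_iff_surjective_up_to_refinements]
    intro U u
    obtain ⟨V, p, hp, v, hv⟩ :=
      surjective_up_to_refinements_of_epi T.arrow.unop (u ≫ kernel.ι t)
    have hv' : v ≫ T'.arrow.unop = 0 := by
      rw [← ht, ← Category.assoc, ← hv]
      simp
    refine ⟨V, p, hp, h'.exact.lift v hv', ?_⟩
    rw [← cancel_mono (kernel.ι t), Category.assoc, hv, Category.assoc, hc, ← Category.assoc]
    exact congrArg (· ≫ T.arrow.unop) (h'.exact.lift_f v hv').symm
  have hzero : S.ofLE S' hS ≫ c = 0 := by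
    rw [← cancel_mono (kernel.ι t), Category.assoc, hc, Subobject.ofLE_arrow_assoc, w, zero_comp]
  have hiso : C.op (cokernel (T'.ofLE T hT)) ↔ C (kernel t) :=
    C.op.prop_iff_of_iso (kernelUnopOp (T'.ofLE T hT)).symm
  rw [hiso]
  constructor
  · intro hC
    have hf : cokernel.π _ ≫ cokernel.desc _ c hzero = c := cokernel.π_desc _ _ _
    have := epi_of_epi_fac hf
    exact C.prop_of_epi (cokernel.desc _ c hzero) hC
  · intro hC
    refine prop_cokernel_of_exact _ c hC hzero fun {U} u hu => ?_
    have hu' : (u ≫ S'.arrow) ≫ T.arrow.unop = 0 := by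
      rw [Category.assoc, ← hc, ← Category.assoc, hu, zero_comp]
    refine ⟨h.exact.lift _ hu', ?_⟩
    rw [← cancel_mono S'.arrow, Category.assoc, Subobject.ofLE_arrow]
    exact h.exact.lift_f _ hu'

theorem isRelativelyArtinian_iff (C : ObjectProperty D) [C.IsSerreClass] :
    IsRelativelyArtinian C ↔ IsRelativelyNoetherian C.op := by
  constructor
  · intro h Y f hf hC
    choose g hg using fun n => exists_isDual_left (f n)
    have hanti : Antitone g := fun n m hnm => ((hg m).le_iff (hg n)).2 (hf hnm)
    obtain ⟨n, hn⟩ := h Y.unop g hanti fun n =>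
      ((hg (n + 1)).prop_cokernel_iff C (hg n) _ _).2 (hC n)
    exact ⟨n, fun m hm => ((hg _).eq_iff (hg _)).1 (hn m hm)⟩
  · intro h X f hf hC
    choose g hg using fun n => exists_isDual_right (Y := op X) (f n)
    have hmono : Monotone g := fun n m hnm => ((hg m).le_iff (hg n)).1 (hf hnm)
    obtain ⟨n, hn⟩ := h (op X) g hmono fun n =>
      ((hg (n + 1)).prop_cokernel_iff C (hg n) _ _).1 (hC n)
    exact ⟨n, fun m hm => ((hg _).eq_iff (hg _)).2 (hn m hm)⟩

end Duality

end RelativeInd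

theorem mainTheorem5 {D : Type u} [Category.{v} D] [Abelian D]
    (C : ObjectProperty D) [C.IsSerreClass]
    (κ : Cardinal.{v}) (hκ : Cardinal.aleph0 ≤ κ) :
    (RelativeInd.IsEquivalentToAbelian (RelativeInd.RelInd.conflations κ C) ↔
        RelativeInd.IsRelativelyNoetherian C) ∧
      (RelativeInd.IsEquivalentToAbelian (RelativeInd.RelPro.conflations κ C) ↔
        RelativeInd.IsRelativelyArtinian C) := by
  refine ⟨RelativeInd.RelInd.isEquivalentToAbelian_iff C hκ, ?_⟩
  rw [RelativeInd.isRelativelyArtinian_iff, ← RelativeInd.RelInd.isEquivalentToAbelian_iff C.op hκ]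
  exact RelativeInd.isEquivalentToAbelian_op_iff fun S => Iff.rfl
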